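/- **Conventions.** Let $e_i$ be the standard basis vectors of a Euclidean space $\mathbb R^d$ and let $s_v$ denote the orthogonal reflection in the hyperplane $v^\perp$. Given a list of simple roots $\alpha_1,\dots,\alpha_n\in\mathbb R^d$, put $s_k=s_{\alpha_k}$, let $W=\langle s_1,\dots,s_n\rangle$ be the Weyl group, $T=\{ws_kw^{-1}\mid w\in W,\ 1\le k\le n\}$ its set of reflections, $\Phi=\{w(\alpha_k)\mid w\in W,\ 1\le k\le n\}$ the root system, and $\Phi^{+}$ (resp. $\Phi^-$) the set of roots whose coefficients in the basis $(\alpha_k)$ are all $\ge 0$ (resp. $\le 0$). An expression $s_{i_1}\cdots s_{i_m}$ is reduced if no expression with fewer simple reflections has the same product, and palindromic if it reads the same forwards and backwards. For $\alpha\in\Phi^+$ let $N(\alpha)=\{\beta\in\Phi^+\mid s_\alpha(\beta)\in\Phi^-\}$, let $\alpha^\vee=2\alpha/(\alpha,\alpha)$, and let $\operatorname{ht}(\alpha^\vee)$ be the sum of the coefficients of $\alpha^\vee$ in the basis $(\alpha_k^\vee)$. Products such as $s_is_{i+1}\cdots s_{j}$ with $j=i-1$ are empty. **Simple roots.** - $A_n$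 ($n\ge1$), in $\mathbb R^{n+1}$: $\alpha_k=e_k-e_{k+1}$ for $1\le k\le n$. - $B_n$, $C_n$ ($n\ge2$) and $D_n$ ($n\ge4$), in $\mathbb R^n$: $\alpha_k=e_k-e_{k+1}$ for $k<n$, and $\alpha_n=e_n$, $2e_n$, $e_{n-1}+e_n$ respectively. - $E_n$ ($n=6,7,8$), in $\mathbb R^8$: the first $n$ of $\alpha_1=\frac12(e_1+e_8)-\frac12(e_2+\cdots+e_7)$, $\alpha_2=e_1+e_2$, $\alpha_k=e_{k-1}-e_{k-2}$ ($3\le k\le 8$). - $F_4$, in $\mathbb R^4$: $e_2-e_3,\ e_3-e_4,\ e_4,\ \frac12(e_1-e_2-e_3-e_4)$. - $G_2$, in $\mathbb R^3$: $e_1-e_2,\ -2e_1+e_2+e_3$. **Theorem.** In each type, the following lists give a palindromic reduced expression for $s_\alpha$ for every positive root $\alpha$. Each positive root occurs exactly once, and each reflection in $T$ is given by exactly one of the expressions. If the expression is split as $w\,s_k\,w^{-1}$ at its middle letter $s_k$, then $w(\alpha_k)=\alpha$. The length of the expression is $|N(\alpha)|$, and in types $A_n,D_n,E_6,E_7,E_8$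 it is $2\operatorname{ht}(\alpha^\vee)-1$. - ($A_n$) For $1\le i\le j\le n$: $s_{e_i-e_{j+1}}=s_is_{i+1}\cdots s_{j-1}\,s_j\,s_{j-1}\cdots s_{i+1}s_i$. - ($B_n$) For $1\le i<j\le n$: $s_{e_i-e_j}=s_i\cdots s_{j-2}\,s_{j-1}\,s_{j-2}\cdots s_i$, and $s_{e_i+e_j}=w_{ij}\,(s_ns_{n-1}s_n)\,w_{ij}^{-1}$ with $w_{ij}=s_js_{j+1}\cdots s_{n-1}\cdot s_is_{i+1}\cdots s_{n-2}$ (and $w_{ij}^{-1}$ written as the reversed word); for $1\le i\le n$: $s_{e_i}=s_i\cdots s_{n-1}\,s_n\,s_{n-1}\cdots s_i$. - ($C_n$) The same words, with $s_{e_i}$ replaced by $s_{2e_i}$. - ($D_n$) $s_{e_i-e_j}=s_i\cdots s_{j-2}\,s_{j-1}\,s_{j-2}\cdots s_i$ for $1\le i<j\le n$; $s_{e_i+e_n}=s_i\cdots s_{n-2}\,s_n\,s_{n-2}\cdots s_i$ for $1\le i<n$; $s_{e_i+e_j}=w_{ij}\,(s_{n-1}s_{n-2}s_ns_{n-2}s_{n-1})\,w_{ij}^{-1}$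 with $w_{ij}=s_j\cdots s_{n-2}\cdot s_i\cdots s_{n-3}$, for $1\le i<j<n$. - ($E_6$) Table 1. ($E_7$) Tables 1 and 2. ($E_8$) Tables 1, 2, 3 and 4. ($F_4$) Table 5. ($G_2$) Table 6. In the tables each row describes a positive root $\alpha$ by the coordinates of $2\alpha$ and by its coefficients, $\alpha=\sum_k c_k\alpha_k$ with $(c_k)$ written as the string $c_1c_2\cdots$ (coefficients missing at the end are $0$), and these two descriptions agree; a word $i_1i_2\cdots i_m$ stands for $s_{i_1}s_{i_2}\cdots s_{i_m}$. In Table 4 the expression is $s_\alpha=w\,s_\theta\,w^{-1}$ with the word $16524342561$ for $s_\theta$ and the reversed word of $w$ for $w^{-1}$. Table 1. $$\begin{array}{lll} 2\alpha & (c_k) & \text{word}\\ \hline (1,-1,-1,-1,-1,-1,-1,1) & 100000 & 1\\ (-1,1,-1,-1,-1,-1,-1,1) & 101000 & 131\\ (-1,-1,1,-1,-1,-1,-1,1) & 101100 & 13431\\ (1,1,1,-1,-1,-1,-1,1) & 111100 & 1342431\\ (-2,2,0,0,0,0,0,0) & 001000 & 3\\ (-2,0,2,0,0,0,0,0) & 001100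 & 343\\ (0,-2,2,0,0,0,0,0) & 000100 & 4\\ (2,2,0,0,0,0,0,0) & 010000 & 2\\ (2,0,2,0,0,0,0,0) & 010100 & 424\\ (0,2,2,0,0,0,0,0) & 011100 & 34243\\ (0,0,-2,2,0,0,0,0) & 000010 & 5\\ (0,-2,0,2,0,0,0,0) & 000110 & 454\\ (-2,0,0,2,0,0,0,0) & 001110 & 34543\\ (-1,-1,-1,1,-1,-1,-1,1) & 101110 & 1345431\\ (1,1,-1,1,-1,-1,-1,1) & 111110 & 132454231\\ (1,-1,1,1,-1,-1,-1,1) & 111210 & 41324542314\\ (-1,1,1,1,-1,-1,-1,1) & 112210 & 3413245423143\\ (2,0,0,2,0,0,0,0) & 010110 & 24542\\ (0,2,0,2,0,0,0,0) & 011110 & 3245423\\ (0,0,2,2,0,0,0,0) & 011210 & 432454234\\ (0,0,0,-2,2,0,0,0) & 000001 & 6\\ (0,0,-2,0,2,0,0,0) & 000011 & 656\\ (0,-2,0,0,2,0,0,0) & 000111 & 65456\\ (-2,0,0,0,2,0,0,0) & 001111 & 6543456\\ (2,0,0,0,2,0,0,0) & 010111 & 6542456\\ (0,2,0,0,2,0,0,0)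 & 011111 & 652434256\\ (0,0,2,0,2,0,0,0) & 011211 & 46524342564\\ (0,0,0,2,2,0,0,0) & 011221 & 5465243425645\\ (-1,-1,-1,-1,1,-1,-1,1) & 101111 & 134565431\\ (1,1,-1,-1,1,-1,-1,1) & 111111 & 16524342561\\ (1,-1,1,-1,1,-1,-1,1) & 111211 & 1465243425641\\ (1,-1,-1,1,1,-1,-1,1) & 111221 & 154652434256451\\ (-1,1,1,-1,1,-1,-1,1) & 112211 & 314652434256413\\ (-1,1,-1,1,1,-1,-1,1) & 112221 & 31546524342564513\\ (-1,-1,1,1,1,-1,-1,1) & 112321 & 4315465243425645134\\ (1,1,1,1,1,-1,-1,1) & 122321 & 243154652434256451342\\ \end{array}$$ Table 2. $$\begin{array}{lll} 2\alpha & (c_k) & \text{word}\\ \hline (0,0,0,0,-2,2,0,0) & 0000001 & 7\\ (0,0,0,-2,0,2,0,0) & 0000011 & 767\\ (0,0,-2,0,0,2,0,0) & 0000111 & 76567\\ (0,-2,0,0,0,2,0,0) & 0001111 & 7654567\\ (-2,0,0,0,0,2,0,0) & 0011111 & 765434567\\ (2,0,0,0,0,2,0,0) & 0101111 & 765424567\\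 (0,2,0,0,0,2,0,0) & 0111111 & 76524342567\\ (0,0,2,0,0,2,0,0) & 0112111 & 4765243425674\\ (0,0,0,2,0,2,0,0) & 0112211 & 547652434256745\\ (0,0,0,0,2,2,0,0) & 0112221 & 65476524342567456\\ (-1,-1,-1,-1,-1,1,-1,1) & 1011111 & 13456765431\\ (1,1,-1,-1,-1,1,-1,1) & 1111111 & 7165243425617\\ (1,-1,1,-1,-1,1,-1,1) & 1112111 & 714652434256417\\ (1,-1,-1,1,-1,1,-1,1) & 1112211 & 71546524342564517\\ (-1,1,1,-1,-1,1,-1,1) & 1122111 & 73146524342564137\\ (-1,1,-1,1,-1,1,-1,1) & 1122211 & 7315465243425645137\\ (-1,-1,1,1,-1,1,-1,1) & 1123211 & 743154652434256451347\\ (1,1,1,1,-1,1,-1,1) & 1223211 & 72431546524342564513427\\ (1,-1,-1,-1,1,1,-1,1) & 1112221 & 6715465243425645176\\ (-1,1,-1,-1,1,1,-1,1) & 1122221 & 673154652434256451376\\ (-1,-1,1,-1,1,1,-1,1) & 1123221 & 67431546524342564513476\\ (1,1,1,-1,1,1,-1,1) & 1223221 & 6724315465243425645134276\\ (-1,-1,-1,1,1,1,-1,1)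 & 1123321 & 5674315465243425645134765\\ (1,1,-1,1,1,1,-1,1) & 1223321 & 256743154652434256451347652\\ (1,-1,1,1,1,1,-1,1) & 1224321 & 42567431546524342564513476524\\ (-1,1,1,1,1,1,-1,1) & 1234321 & 3425674315465243425645134765243\\ (0,0,0,0,0,0,-2,2) & 2234321 & 134256743154652434256451347652431\\ \end{array}$$ Table 3. $$\begin{array}{lll} 2\alpha & (c_k) & \text{word}\\ \hline (0,0,0,0,0,-2,2,0) & 00000001 & 8\\ (0,0,0,0,-2,0,2,0) & 00000011 & 878\\ (0,0,0,-2,0,0,2,0) & 00000111 & 87678\\ (0,0,-2,0,0,0,2,0) & 00001111 & 8765678\\ (0,-2,0,0,0,0,2,0) & 00011111 & 876545678\\ (-2,0,0,0,0,0,2,0) & 00111111 & 87654345678\\ (2,0,0,0,0,0,2,0) & 01011111 & 87654245678\\ (0,2,0,0,0,0,2,0) & 01111111 & 8765243425678\\ (0,0,2,0,0,0,2,0) & 01121111 & 487652434256784\\ (0,0,0,2,0,0,2,0) & 01122111 & 54876524342567845\\ (0,0,0,0,2,0,2,0) & 01122211 & 6548765243425678456\\ (0,0,0,0,0,2,2,0)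 & 01122221 & 765487652434256784567\\ (-1,-1,-1,-1,-1,-1,1,1) & 10111111 & 1345678765431\\ \end{array}$$ Table 4. $$\begin{array}{lll} 2\alpha & (c_k) & \text{word of }w\text{}\\ \hline (1,1,-1,-1,-1,-1,1,1) & 11111111 & 87\\ (1,-1,1,-1,-1,-1,1,1) & 11121111 & 487\\ (-1,1,1,-1,-1,-1,1,1) & 11221111 & 3487\\ (-1,1,-1,1,-1,-1,1,1) & 11222111 & 53487\\ (-1,-1,1,1,-1,-1,1,1) & 11232111 & 453487\\ (1,1,1,1,-1,-1,1,1) & 12232111 & 2453487\\ (1,1,1,-1,1,-1,1,1) & 12232211 & 62453487\\ (1,-1,-1,1,-1,-1,1,1) & 11122111 & 5487\\ (1,-1,-1,-1,1,-1,1,1) & 11122211 & 65487\\ (-1,1,-1,-1,1,-1,1,1) & 11222211 & 365487\\ (-1,-1,1,-1,1,-1,1,1) & 11232211 & 4365487\\ (-1,-1,-1,1,1,-1,1,1) & 11233211 & 54365487\\ (1,1,-1,1,1,-1,1,1) & 12233211 & 254365487\\ (1,-1,1,1,1,-1,1,1) & 12243211 & 4254365487\\ (-1,1,1,1,1,-1,1,1)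 & 12343211 & 34254365487\\ (0,0,0,0,0,-2,0,2) & 22343211 & 134254365487\\ (1,-1,-1,-1,-1,1,1,1) & 11122221 & 765487\\ (-1,1,-1,-1,-1,1,1,1) & 11222221 & 3765487\\ (-1,-1,1,-1,-1,1,1,1) & 11232221 & 43765487\\ (1,1,1,-1,-1,1,1,1) & 12232221 & 243765487\\ (1,1,-1,1,-1,1,1,1) & 12233221 & 5243765487\\ (1,-1,1,1,-1,1,1,1) & 12243221 & 45243765487\\ (-1,1,1,1,-1,1,1,1) & 12343221 & 345243765487\\ (0,0,0,0,-2,0,0,2) & 22343221 & 1345243765487\\ (-1,-1,-1,1,-1,1,1,1) & 11233221 & 543765487\\ (-1,-1,-1,-1,1,1,1,1) & 11233321 & 6543765487\\ (1,1,-1,-1,1,1,1,1) & 12233321 & 26543765487\\ (1,-1,1,-1,1,1,1,1) & 12243321 & 426543765487\\ (-1,1,1,-1,1,1,1,1) & 12343321 & 3426543765487\\ (0,0,0,-2,0,0,0,2) & 22343321 & 13426543765487\\ (0,0,-2,0,0,0,0,2) & 22344321 & 513426543765487\\ (0,-2,0,0,0,0,0,2) & 22354321 & 4513426543765487\\ (-2,0,0,0,0,0,0,2)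 & 22454321 & 34513426543765487\\ (1,-1,-1,1,1,1,1,1) & 12244321 & 5426543765487\\ (-1,1,-1,1,1,1,1,1) & 12344321 & 35426543765487\\ (-1,-1,1,1,1,1,1,1) & 12354321 & 435426543765487\\ (1,1,1,1,1,1,1,1) & 13354321 & 2435426543765487\\ (2,0,0,0,0,0,0,2) & 23354321 & 12435426543765487\\ (0,2,0,0,0,0,0,2) & 23454321 & 312435426543765487\\ (0,0,2,0,0,0,0,2) & 23464321 & 4312435426543765487\\ (0,0,0,2,0,0,0,2) & 23465321 & 54312435426543765487\\ (0,0,0,0,2,0,0,2) & 23465421 & 654312435426543765487\\ (0,0,0,0,0,2,0,2) & 23465431 & 7654312435426543765487\\ (0,0,0,0,0,0,2,2) & 23465432 & 87654312435426543765487\\ \end{array}$$ Table 5. $$\begin{array}{lll} 2\alpha & (c_k) & \text{word}\\ \hline (0,2,-2,0) & 1000 & 1\\ (0,0,2,-2) & 0100 & 2\\ (0,2,0,-2) & 1100 & 121\\ (0,2,0,0) & 1110 & 12321\\ (0,0,2,0) & 0110 & 232\\ (0,0,0,2) & 0010 & 3\\ (0,0,2,2) & 0120 & 323\\ (0,2,0,2)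 & 1120 & 13231\\ (0,2,2,0) & 1220 & 2132312\\ (1,-1,-1,-1) & 0001 & 4\\ (1,-1,-1,1) & 0011 & 434\\ (1,-1,1,-1) & 0111 & 42324\\ (1,-1,1,1) & 0121 & 3423243\\ (2,-2,0,0) & 0122 & 43234\\ (1,1,-1,-1) & 1111 & 1423241\\ (1,1,-1,1) & 1121 & 134232431\\ (1,1,1,-1) & 1221 & 21342324312\\ (1,1,1,1) & 1231 & 3213423243123\\ (2,0,-2,0) & 1122 & 1432341\\ (2,0,0,-2) & 1222 & 214323412\\ (2,0,0,2) & 1242 & 32143234123\\ (2,0,2,0) & 1342 & 2321432341232\\ (2,0,0,0) & 1232 & 432134232431234\\ (2,2,0,0) & 2342 & 123214323412321\\ \end{array}$$ Table 6. $$\begin{array}{lll} 2\alpha & (c_k) & \text{word}\\ \hline (2,-2,0) & 10 & 1\\ (-4,2,2) & 01 & 2\\ (-2,0,2) & 11 & 212\\ (2,-4,2) & 31 & 121\\ (0,-2,2) & 21 & 12121\\ (-2,-2,4) & 32 & 21212\\ \end{array}$$ -/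

import Mathlib

open scoped RealInnerProductSpace

noncomputable section

namespace WeylWords

/-! ### Reflection groups given by simple roots

Throughout, `n` is the rank and `α : ℕ → Vec d` lists the simple roots `α 1, …, α n`;
the values of `α` outside `{1, …, n}` are never used. Words in the simple reflections are
lists of labels in `{1, …, n}`. -/

/-- The Euclidean space `ℝ^d`. -/
abbrev Vec (d : ℕ) := EuclideanSpace ℝ (Fin d)

/-- The standard basis vector `e_i` of `ℝ^d`, for `1 ≤ i ≤ d`. -/
def e (d i : ℕ) : Vec d := WithLp.toLp 2 fun k => if (k : ℕ) + 1 = i then 1 else 0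

/-- `s_v`: the orthogonal reflection in the hyperplane orthogonal to `v`. -/
def hypRefl {d : ℕ} (v : Vec d) : Vec d ≃ₗᵢ[ℝ] Vec d := (Submodule.span ℝ {v})ᗮ.reflection

/-- The group generated by the simple reflections `s_1, …, s_n`. -/
def weylGroup {d : ℕ} (n : ℕ) (α : ℕ → Vec d) : Subgroup (Vec d ≃ₗᵢ[ℝ] Vec d) :=
  Subgroup.closure {s | ∃ k, 1 ≤ k ∧ k ≤ n ∧ s = hypRefl (α k)}

/-- The set `T` of reflections: the conjugates of the simple reflections. -/
def reflections {d : ℕ} (n : ℕ) (α : ℕ → Vec d) : Set (Vec d ≃ₗᵢ[ℝ] Vec d) :=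
  {t | ∃ w ∈ weylGroup n α, ∃ k, 1 ≤ k ∧ k ≤ n ∧ t = w * hypRefl (α k) * w⁻¹}

/-- The root system `Φ`: the orbit of the simple roots. -/
def roots {d : ℕ} (n : ℕ) (α : ℕ → Vec d) : Set (Vec d) :=
  {v | ∃ w ∈ weylGroup n α, ∃ k, 1 ≤ k ∧ k ≤ n ∧ v = w (α k)}

/-- The positive roots `Φ⁺`. -/
def posRoots {d : ℕ} (n : ℕ) (α : ℕ → Vec d) : Set (Vec d) :=
  {v | v ∈ roots n α ∧ ∃ c : ℕ → ℝ, (∀ k, 0 ≤ c k) ∧ v = ∑ k ∈ Finset.Icc 1 n, c k • α k}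

/-- The negative roots `Φ⁻`. -/
def negRoots {d : ℕ} (n : ℕ) (α : ℕ → Vec d) : Set (Vec d) :=
  {v | v ∈ roots n α ∧ ∃ c : ℕ → ℝ, (∀ k, c k ≤ 0) ∧ v = ∑ k ∈ Finset.Icc 1 n, c k • α k}

/-- `N(w)`: the positive roots that `w` makes negative. -/
def inversions {d : ℕ} (n : ℕ) (α : ℕ → Vec d) (w : Vec d ≃ₗᵢ[ℝ] Vec d) : Set (Vec d) :=
  {v | v ∈ posRoots n α ∧ w v ∈ negRoots n α}

/-- The coroot `v^∨ = 2 v / (v, v)`. -/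
def coroot {d : ℕ} (v : Vec d) : Vec d := (2 / ⟪v, v⟫) • v

/-- `h` is the sum of the coefficients of `v^∨` in the simple coroots. -/
def HasCorootHeight {d : ℕ} (n : ℕ) (α : ℕ → Vec d) (v : Vec d) (h : ℝ) : Prop :=
  ∃ c : ℕ → ℝ, coroot v = ∑ k ∈ Finset.Icc 1 n, c k • coroot (α k) ∧
    ∑ k ∈ Finset.Icc 1 n, c k = h

/-- All letters of `l` are labels of simple reflections. -/
def IsWord (n : ℕ) (l : List ℕ) : Prop := ∀ k ∈ l, 1 ≤ k ∧ k ≤ n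

/-- The product `s_{i_1} s_{i_2} ⋯ s_{i_k}` for `l = [i_1, …, i_k]`. -/
def wordProd {d : ℕ} (α : ℕ → Vec d) (l : List ℕ) : Vec d ≃ₗᵢ[ℝ] Vec d :=
  (l.map fun k => hypRefl (α k)).prod

/-- `l` is a reduced expression: no shorter word has the same product. -/
def IsReduced {d : ℕ} (n : ℕ) (α : ℕ → Vec d) (l : List ℕ) : Prop :=
  IsWord n l ∧ ∀ l', IsWord n l' → wordProd α l' = wordProd α l → l.length ≤ l'.length

/-- `l` is a palindromic reduced expression for the reflection `s_β`. Writing `l` as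
`w s_k w⁻¹` with `s_k` the middle letter, `w` maps `α_k` to `β`, and the length of `l`
is the number of inversions of `s_β`. -/
structure IsPalindromicReduced {d : ℕ} (n : ℕ) (α : ℕ → Vec d) (β : Vec d) (l : List ℕ) :
    Prop where
  palindrome : l.reverse = l
  reduced : IsReduced n α l
  prod_eq : wordProd α l = hypRefl β
  conj : ∃ u k, l = u ++ [k] ++ u.reverse ∧ wordProd α u (α k) = β
  length_eq : l.length = (inversions n α (hypRefl β)).ncard

/-- The words `word x`, for `x ∈ I`, are palindromic reduced expressions for the reflections
`s_{root x}`; each positive root and each reflection occurs for exactly one `x ∈ I`. -/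
structure IsReflectionTable {d : ℕ} (n : ℕ) (α : ℕ → Vec d) {ι : Type} (I : Set ι)
    (root : ι → Vec d) (word : ι → List ℕ) : Prop where
  expr : ∀ x ∈ I, IsPalindromicReduced n α (root x) (word x)
  bijOn_posRoots : Set.BijOn root I (posRoots n α)
  bijOn_reflections : Set.BijOn (fun x => wordProd α (word x)) I (reflections n α)

/-- Each word has length `2 ht(β^∨) - 1`, where `β` is its root. -/
def LengthsFromHeights {d : ℕ} (n : ℕ) (α : ℕ → Vec d) {ι : Type} (I : Set ι)
    (root : ι → Vec d) (word : ι → List ℕ) : Prop :=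
  ∀ x ∈ I, ∃ h : ℝ, HasCorootHeight n α (root x) h ∧ ((word x).length : ℝ) = 2 * h - 1

/-! ### The classical types

`List.Ico a b = [a, a+1, …, b-1]`. -/

/-- Simple roots of type `A_n` in `ℝ^{n+1}`. -/
def simpleA (n k : ℕ) : Vec (n + 1) := e (n + 1) k - e (n + 1) (k + 1)

/-- Simple roots of type `B_n` in `ℝ^n`. -/
def simpleB (n k : ℕ) : Vec n := if k = n then e n n else e n k - e n (k + 1)

/-- Simple roots of type `C_n` in `ℝ^n`. -/
def simpleC (n k : ℕ) : Vec n := if k = n then (2 : ℝ) • e n n else e n k - e n (k + 1)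

/-- Simple roots of type `D_n` in `ℝ^n`. -/
def simpleD (n k : ℕ) : Vec n := if k = n then e n (n - 1) + e n n else e n k - e n (k + 1)

/-- In type `A_n` the positive roots `e_i - e_{j+1}` are labelled by `1 ≤ i ≤ j ≤ n`. -/
def labelsA (n : ℕ) : Set (ℕ × ℕ) := {p | 1 ≤ p.1 ∧ p.1 ≤ p.2 ∧ p.2 ≤ n}

/-- `e_i - e_{j+1}` -/
def rootA (n : ℕ) (p : ℕ × ℕ) : Vec (n + 1) := e (n + 1) p.1 - e (n + 1) (p.2 + 1)

/-- `s_i ⋯ s_{j-1} s_j s_{j-1} ⋯ s_i` -/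
def wordA (p : ℕ × ℕ) : List ℕ :=
  List.Ico p.1 p.2 ++ [p.2] ++ (List.Ico p.1 p.2).reverse

/-- Names for the positive roots `e_i - e_j`, `e_i + e_j` and `e_i` (type `B_n`) or `2 e_i`
(type `C_n`). -/
inductive LabelBC where
  | diff (i j : ℕ) : LabelBC
  | plus (i j : ℕ) : LabelBC
  | axis (i : ℕ) : LabelBC

/-- The labels with `1 ≤ i < j ≤ n`, respectively `1 ≤ i ≤ n`. -/
def labelsBC (n : ℕ) : Set LabelBC := {x | match x with
  | .diff i j => 1 ≤ i ∧ i < j ∧ j ≤ n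
  | .plus i j => 1 ≤ i ∧ i < j ∧ j ≤ n
  | .axis i => 1 ≤ i ∧ i ≤ n}

/-- The positive roots in type `B_n`. -/
def rootB (n : ℕ) : LabelBC → Vec n
  | .diff i j => e n i - e n j
  | .plus i j => e n i + e n j
  | .axis i => e n i

/-- The positive roots in type `C_n`. -/
def rootC (n : ℕ) : LabelBC → Vec n
  | .diff i j => e n i - e n j
  | .plus i j => e n i + e n j
  | .axis i => (2 : ℝ) • e n i

/-- The conjugating word `s_j ⋯ s_{n-1} · s_i ⋯ s_{n-2}` in types `B_n` and `C_n`. -/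
def conjBC (n i j : ℕ) : List ℕ := List.Ico j n ++ List.Ico i (n - 1)

/-- The words in types `B_n` and `C_n`. -/
def wordBC (n : ℕ) : LabelBC → List ℕ
  | .diff i j => List.Ico i (j - 1) ++ [j - 1] ++ (List.Ico i (j - 1)).reverse
  | .plus i j => conjBC n i j ++ [n, n - 1, n] ++ (conjBC n i j).reverse
  | .axis i => List.Ico i n ++ [n] ++ (List.Ico i n).reverse

/-- Names for the positive roots `e_i - e_j` and `e_i + e_j` in type `D_n`. -/
inductive LabelD where
  | diff (i j : ℕ) : LabelD
  | plus (i j : ℕ) : LabelD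

/-- The labels with `1 ≤ i < j ≤ n`. -/
def labelsD (n : ℕ) : Set LabelD := {x | match x with
  | .diff i j => 1 ≤ i ∧ i < j ∧ j ≤ n
  | .plus i j => 1 ≤ i ∧ i < j ∧ j ≤ n}

/-- The positive roots in type `D_n`. -/
def rootD (n : ℕ) : LabelD → Vec n
  | .diff i j => e n i - e n j
  | .plus i j => e n i + e n j

/-- The conjugating word `s_j ⋯ s_{n-2} · s_i ⋯ s_{n-3}` in type `D_n`. -/
def conjD (n i j : ℕ) : List ℕ := List.Ico j (n - 1) ++ List.Ico i (n - 2)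

/-- The words in type `D_n`. -/
def wordD (n : ℕ) : LabelD → List ℕ
  | .diff i j => List.Ico i (j - 1) ++ [j - 1] ++ (List.Ico i (j - 1)).reverse
  | .plus i j =>
    if j = n then List.Ico i (n - 1) ++ [n] ++ (List.Ico i (n - 1)).reverse
    else conjD n i j ++ [n - 1, n - 2, n, n - 2, n - 1] ++ (conjD n i j).reverse

/-! ### The exceptional types -/

/-- Simple roots of types `E_6`, `E_7`, `E_8` in `ℝ^8` (the first `6`, `7`, `8` of them). -/
def simpleE : ℕ → Vec 8
  | 0 => 0
  | 1 => (1 / 2 : ℝ) • (e 8 1 + e 8 8) -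
      (1 / 2 : ℝ) • (e 8 2 + e 8 3 + e 8 4 + e 8 5 + e 8 6 + e 8 7)
  | 2 => e 8 1 + e 8 2
  | k + 3 => e 8 (k + 2) - e 8 (k + 1)

/-- Simple roots of type `F_4` in `ℝ^4`. -/
def simpleF : ℕ → Vec 4
  | 1 => e 4 2 - e 4 3
  | 2 => e 4 3 - e 4 4
  | 3 => e 4 4
  | 4 => (1 / 2 : ℝ) • (e 4 1 - e 4 2 - e 4 3 - e 4 4)
  | _ => 0

/-- Simple roots of type `G_2` in `ℝ^3`. -/
def simpleG : ℕ → Vec 3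
  | 1 => e 3 1 - e 3 2
  | 2 => (-2 : ℝ) • e 3 1 + e 3 2 + e 3 3
  | _ => 0

/-- A row of a table: twice the standard coordinates of a positive root, its coefficients in
the simple roots (trailing zeros may be omitted), and a word for its reflection. -/
structure Row where
  coords : List ℤ
  coeffs : List ℕ
  word : List ℕ

/-- The root of a row as a vector in `ℝ^d`. -/
def Row.root (d : ℕ) (r : Row) : Vec d :=
  WithLp.toLp 2 fun k => ((r.coords.getD (k : ℕ) 0 : ℤ) : ℝ) / 2

/-- The linear combination of the simple roots that a row records. -/
def Row.expansion {d : ℕ} (n : ℕ) (α : ℕ → Vec d) (r : Row) : Vec d :=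
  ∑ k ∈ Finset.Icc 1 n, ((r.coeffs.getD (k - 1) 0 : ℕ) : ℝ) • α k

/-- `tbl` is a complete table of positive roots in `ℝ^d`, of their expansions in the simple
roots, and of palindromic reduced expressions for their reflections. -/
structure IsExceptionalTable {d : ℕ} (n : ℕ) (α : ℕ → Vec d) (tbl : List Row) : Prop where
  table : IsReflectionTable n α (Set.univ : Set (Fin tbl.length))
    (fun x => (tbl.get x).root d) (fun x => (tbl.get x).word)
  expansion : ∀ r ∈ tbl, r.root d = r.expansion n α

/-- The table of type `G_2`. -/
def tableG2 : List Row :=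
  [
   ⟨[2, -2, 0], [1, 0], [1]⟩,
   ⟨[-4, 2, 2], [0, 1], [2]⟩,
   ⟨[-2, 0, 2], [1, 1], [2, 1, 2]⟩,
   ⟨[2, -4, 2], [3, 1], [1, 2, 1]⟩,
   ⟨[0, -2, 2], [2, 1], [1, 2, 1, 2, 1]⟩,
   ⟨[-2, -2, 4], [3, 2], [2, 1, 2, 1, 2]⟩]

/-- The table of type `F_4`. -/
def tableF4 : List Row :=
  [
   ⟨[0, 2, -2, 0], [1, 0, 0, 0], [1]⟩,
   ⟨[0, 0, 2, -2], [0, 1, 0, 0], [2]⟩,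
   ⟨[0, 2, 0, -2], [1, 1, 0, 0], [1, 2, 1]⟩,
   ⟨[0, 2, 0, 0], [1, 1, 1, 0], [1, 2, 3, 2, 1]⟩,
   ⟨[0, 0, 2, 0], [0, 1, 1, 0], [2, 3, 2]⟩,
   ⟨[0, 0, 0, 2], [0, 0, 1, 0], [3]⟩,
   ⟨[0, 0, 2, 2], [0, 1, 2, 0], [3, 2, 3]⟩,
   ⟨[0, 2, 0, 2], [1, 1, 2, 0], [1, 3, 2, 3, 1]⟩,
   ⟨[0, 2, 2, 0], [1, 2, 2, 0], [2, 1, 3, 2, 3, 1, 2]⟩,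
   ⟨[1, -1, -1, -1], [0, 0, 0, 1], [4]⟩,
   ⟨[1, -1, -1, 1], [0, 0, 1, 1], [4, 3, 4]⟩,
   ⟨[1, -1, 1, -1], [0, 1, 1, 1], [4, 2, 3, 2, 4]⟩,
   ⟨[1, -1, 1, 1], [0, 1, 2, 1], [3, 4, 2, 3, 2, 4, 3]⟩,
   ⟨[2, -2, 0, 0], [0, 1, 2, 2], [4, 3, 2, 3, 4]⟩,
   ⟨[1, 1, -1, -1], [1, 1, 1, 1], [1, 4, 2, 3, 2, 4, 1]⟩,
   ⟨[1, 1, -1, 1], [1, 1, 2, 1], [1, 3, 4, 2, 3, 2, 4, 3, 1]⟩,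
   ⟨[1, 1, 1, -1], [1, 2, 2, 1], [2, 1, 3, 4, 2, 3, 2, 4, 3, 1, 2]⟩,
   ⟨[1, 1, 1, 1], [1, 2, 3, 1], [3, 2, 1, 3, 4, 2, 3, 2, 4, 3, 1, 2, 3]⟩,
   ⟨[2, 0, -2, 0], [1, 1, 2, 2], [1, 4, 3, 2, 3, 4, 1]⟩,
   ⟨[2, 0, 0, -2], [1, 2, 2, 2], [2, 1, 4, 3, 2, 3, 4, 1, 2]⟩,
   ⟨[2, 0, 0, 2], [1, 2, 4, 2], [3, 2, 1, 4, 3, 2, 3, 4, 1, 2, 3]⟩,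
   ⟨[2, 0, 2, 0], [1, 3, 4, 2], [2, 3, 2, 1, 4, 3, 2, 3, 4, 1, 2, 3, 2]⟩,
   ⟨[2, 0, 0, 0], [1, 2, 3, 2], [4, 3, 2, 1, 3, 4, 2, 3, 2, 4, 3, 1, 2, 3, 4]⟩,
   ⟨[2, 2, 0, 0], [2, 3, 4, 2], [1, 2, 3, 2, 1, 4, 3, 2, 3, 4, 1, 2, 3, 2, 1]⟩]

/-- The table of type `E_6`. -/
def tableE6 : List Row :=
  [
   ⟨[1, -1, -1, -1, -1, -1, -1, 1], [1, 0, 0, 0, 0, 0], [1]⟩,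
   ⟨[-1, 1, -1, -1, -1, -1, -1, 1], [1, 0, 1, 0, 0, 0], [1, 3, 1]⟩,
   ⟨[-1, -1, 1, -1, -1, -1, -1, 1], [1, 0, 1, 1, 0, 0], [1, 3, 4, 3, 1]⟩,
   ⟨[1, 1, 1, -1, -1, -1, -1, 1], [1, 1, 1, 1, 0, 0], [1, 3, 4, 2, 4, 3, 1]⟩,
   ⟨[-2, 2, 0, 0, 0, 0, 0, 0], [0, 0, 1, 0, 0, 0], [3]⟩,
   ⟨[-2, 0, 2, 0, 0, 0, 0, 0], [0, 0, 1, 1, 0, 0], [3, 4, 3]⟩,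
   ⟨[0, -2, 2, 0, 0, 0, 0, 0], [0, 0, 0, 1, 0, 0], [4]⟩,
   ⟨[2, 2, 0, 0, 0, 0, 0, 0], [0, 1, 0, 0, 0, 0], [2]⟩,
   ⟨[2, 0, 2, 0, 0, 0, 0, 0], [0, 1, 0, 1, 0, 0], [4, 2, 4]⟩,
   ⟨[0, 2, 2, 0, 0, 0, 0, 0], [0, 1, 1, 1, 0, 0], [3, 4, 2, 4, 3]⟩,
   ⟨[0, 0, -2, 2, 0, 0, 0, 0], [0, 0, 0, 0, 1, 0], [5]⟩,
   ⟨[0, -2, 0, 2, 0, 0, 0, 0], [0, 0, 0, 1, 1, 0], [4, 5, 4]⟩,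
   ⟨[-2, 0, 0, 2, 0, 0, 0, 0], [0, 0, 1, 1, 1, 0], [3, 4, 5, 4, 3]⟩,
   ⟨[-1, -1, -1, 1, -1, -1, -1, 1], [1, 0, 1, 1, 1, 0], [1, 3, 4, 5, 4, 3, 1]⟩,
   ⟨[1, 1, -1, 1, -1, -1, -1, 1], [1, 1, 1, 1, 1, 0], [1, 3, 2, 4, 5, 4, 2, 3, 1]⟩,
   ⟨[1, -1, 1, 1, -1, -1, -1, 1], [1, 1, 1, 2, 1, 0], [4, 1, 3, 2, 4, 5, 4, 2, 3, 1, 4]⟩,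
   ⟨[-1, 1, 1, 1, -1, -1, -1, 1], [1, 1, 2, 2, 1, 0], [3, 4, 1, 3, 2, 4, 5, 4, 2, 3, 1, 4, 3]⟩,
   ⟨[2, 0, 0, 2, 0, 0, 0, 0], [0, 1, 0, 1, 1, 0], [2, 4, 5, 4, 2]⟩,
   ⟨[0, 2, 0, 2, 0, 0, 0, 0], [0, 1, 1, 1, 1, 0], [3, 2, 4, 5, 4, 2, 3]⟩,
   ⟨[0, 0, 2, 2, 0, 0, 0, 0], [0, 1, 1, 2, 1, 0], [4, 3, 2, 4, 5, 4, 2, 3, 4]⟩,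
   ⟨[0, 0, 0, -2, 2, 0, 0, 0], [0, 0, 0, 0, 0, 1], [6]⟩,
   ⟨[0, 0, -2, 0, 2, 0, 0, 0], [0, 0, 0, 0, 1, 1], [6, 5, 6]⟩,
   ⟨[0, -2, 0, 0, 2, 0, 0, 0], [0, 0, 0, 1, 1, 1], [6, 5, 4, 5, 6]⟩,
   ⟨[-2, 0, 0, 0, 2, 0, 0, 0], [0, 0, 1, 1, 1, 1], [6, 5, 4, 3, 4, 5, 6]⟩,
   ⟨[2, 0, 0, 0, 2, 0, 0, 0], [0, 1, 0, 1, 1, 1], [6, 5, 4, 2, 4, 5, 6]⟩,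
   ⟨[0, 2, 0, 0, 2, 0, 0, 0], [0, 1, 1, 1, 1, 1], [6, 5, 2, 4, 3, 4, 2, 5, 6]⟩,
   ⟨[0, 0, 2, 0, 2, 0, 0, 0], [0, 1, 1, 2, 1, 1], [4, 6, 5, 2, 4, 3, 4, 2, 5, 6, 4]⟩,
   ⟨[0, 0, 0, 2, 2, 0, 0, 0], [0, 1, 1, 2, 2, 1], [5, 4, 6, 5, 2, 4, 3, 4, 2, 5, 6, 4, 5]⟩,
   ⟨[-1, -1, -1, -1, 1, -1, -1, 1], [1, 0, 1, 1, 1, 1], [1, 3, 4, 5, 6, 5, 4, 3, 1]⟩,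
   ⟨[1, 1, -1, -1, 1, -1, -1, 1], [1, 1, 1, 1, 1, 1], [1, 6, 5, 2, 4, 3, 4, 2, 5, 6, 1]⟩,
   ⟨[1, -1, 1, -1, 1, -1, -1, 1], [1, 1, 1, 2, 1, 1], [1, 4, 6, 5, 2, 4, 3, 4, 2, 5, 6, 4, 1]⟩,
   ⟨[1, -1, -1, 1, 1, -1, -1, 1], [1, 1, 1, 2, 2, 1], [1, 5, 4, 6, 5, 2, 4, 3, 4, 2, 5, 6, 4, 5, 1]⟩,
   ⟨[-1, 1, 1, -1, 1, -1, -1, 1], [1, 1, 2, 2, 1, 1], [3, 1, 4, 6, 5, 2, 4, 3, 4, 2, 5, 6, 4, 1, 3]⟩,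
   ⟨[-1, 1, -1, 1, 1, -1, -1, 1], [1, 1, 2, 2, 2, 1], [3, 1, 5, 4, 6, 5, 2, 4, 3, 4, 2, 5, 6, 4, 5, 1, 3]⟩,
   ⟨[-1, -1, 1, 1, 1, -1, -1, 1], [1, 1, 2, 3, 2, 1], [4, 3, 1, 5, 4, 6, 5, 2, 4, 3, 4, 2, 5, 6, 4, 5, 1, 3, 4]⟩,
   ⟨[1, 1, 1, 1, 1, -1, -1, 1], [1, 2, 2, 3, 2, 1], [2, 4, 3, 1, 5, 4, 6, 5, 2, 4, 3, 4, 2, 5, 6, 4, 5, 1, 3, 4, 2]⟩]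

/-- The rows that type `E_7` adds to those of type `E_6`. -/
def rowsE7 : List Row :=
  [
   ⟨[0, 0, 0, 0, -2, 2, 0, 0], [0, 0, 0, 0, 0, 0, 1], [7]⟩,
   ⟨[0, 0, 0, -2, 0, 2, 0, 0], [0, 0, 0, 0, 0, 1, 1], [7, 6, 7]⟩,
   ⟨[0, 0, -2, 0, 0, 2, 0, 0], [0, 0, 0, 0, 1, 1, 1], [7, 6, 5, 6, 7]⟩,
   ⟨[0, -2, 0, 0, 0, 2, 0, 0], [0, 0, 0, 1, 1, 1, 1], [7, 6, 5, 4, 5, 6, 7]⟩,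
   ⟨[-2, 0, 0, 0, 0, 2, 0, 0], [0, 0, 1, 1, 1, 1, 1], [7, 6, 5, 4, 3, 4, 5, 6, 7]⟩,
   ⟨[2, 0, 0, 0, 0, 2, 0, 0], [0, 1, 0, 1, 1, 1, 1], [7, 6, 5, 4, 2, 4, 5, 6, 7]⟩,
   ⟨[0, 2, 0, 0, 0, 2, 0, 0], [0, 1, 1, 1, 1, 1, 1], [7, 6, 5, 2, 4, 3, 4, 2, 5, 6, 7]⟩,
   ⟨[0, 0, 2, 0, 0, 2, 0, 0], [0, 1, 1, 2, 1, 1, 1], [4, 7, 6, 5, 2, 4, 3, 4, 2, 5, 6, 7, 4]⟩,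
   ⟨[0, 0, 0, 2, 0, 2, 0, 0], [0, 1, 1, 2, 2, 1, 1], [5, 4, 7, 6, 5, 2, 4, 3, 4, 2, 5, 6, 7, 4, 5]⟩,
   ⟨[0, 0, 0, 0, 2, 2, 0, 0], [0, 1, 1, 2, 2, 2, 1], [6, 5, 4, 7, 6, 5, 2, 4, 3, 4, 2, 5, 6, 7, 4, 5, 6]⟩,
   ⟨[-1, -1, -1, -1, -1, 1, -1, 1], [1, 0, 1, 1, 1, 1, 1], [1, 3, 4, 5, 6, 7, 6, 5, 4, 3, 1]⟩,
   ⟨[1, 1, -1, -1, -1, 1, -1, 1], [1, 1, 1, 1, 1, 1, 1], [7, 1, 6, 5, 2, 4, 3, 4, 2, 5, 6, 1, 7]⟩,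
   ⟨[1, -1, 1, -1, -1, 1, -1, 1], [1, 1, 1, 2, 1, 1, 1], [7, 1, 4, 6, 5, 2, 4, 3, 4, 2, 5, 6, 4, 1, 7]⟩,
   ⟨[1, -1, -1, 1, -1, 1, -1, 1], [1, 1, 1, 2, 2, 1, 1], [7, 1, 5, 4, 6, 5, 2, 4, 3, 4, 2, 5, 6, 4, 5, 1, 7]⟩,
   ⟨[-1, 1, 1, -1, -1, 1, -1, 1], [1, 1, 2, 2, 1, 1, 1], [7, 3, 1, 4, 6, 5, 2, 4, 3, 4, 2, 5, 6, 4, 1, 3, 7]⟩,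
   ⟨[-1, 1, -1, 1, -1, 1, -1, 1], [1, 1, 2, 2, 2, 1, 1], [7, 3, 1, 5, 4, 6, 5, 2, 4, 3, 4, 2, 5, 6, 4, 5, 1, 3, 7]⟩,
   ⟨[-1, -1, 1, 1, -1, 1, -1, 1], [1, 1, 2, 3, 2, 1, 1], [7, 4, 3, 1, 5, 4, 6, 5, 2, 4, 3, 4, 2, 5, 6, 4, 5, 1, 3, 4, 7]⟩,
   ⟨[1, 1, 1, 1, -1, 1, -1, 1], [1, 2, 2, 3, 2, 1, 1], [7, 2, 4, 3, 1, 5, 4, 6, 5, 2, 4, 3, 4, 2, 5, 6, 4, 5, 1, 3, 4, 2, 7]⟩,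
   ⟨[1, -1, -1, -1, 1, 1, -1, 1], [1, 1, 1, 2, 2, 2, 1], [6, 7, 1, 5, 4, 6, 5, 2, 4, 3, 4, 2, 5, 6, 4, 5, 1, 7, 6]⟩,
   ⟨[-1, 1, -1, -1, 1, 1, -1, 1], [1, 1, 2, 2, 2, 2, 1], [6, 7, 3, 1, 5, 4, 6, 5, 2, 4, 3, 4, 2, 5, 6, 4, 5, 1, 3, 7, 6]⟩,
   ⟨[-1, -1, 1, -1, 1, 1, -1, 1], [1, 1, 2, 3, 2, 2, 1], [6, 7, 4, 3, 1, 5, 4, 6, 5, 2, 4, 3, 4, 2, 5, 6, 4, 5, 1, 3, 4, 7, 6]⟩,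
   ⟨[1, 1, 1, -1, 1, 1, -1, 1], [1, 2, 2, 3, 2, 2, 1], [6, 7, 2, 4, 3, 1, 5, 4, 6, 5, 2, 4, 3, 4, 2, 5, 6, 4, 5, 1, 3, 4, 2, 7, 6]⟩,
   ⟨[-1, -1, -1, 1, 1, 1, -1, 1], [1, 1, 2, 3, 3, 2, 1], [5, 6, 7, 4, 3, 1, 5, 4, 6, 5, 2, 4, 3, 4, 2, 5, 6, 4, 5, 1, 3, 4, 7, 6, 5]⟩,
   ⟨[1, 1, -1, 1, 1, 1, -1, 1], [1, 2, 2, 3, 3, 2, 1], [2, 5, 6, 7, 4, 3, 1, 5, 4, 6, 5, 2, 4, 3, 4, 2, 5, 6, 4, 5, 1, 3, 4, 7, 6, 5, 2]⟩,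
   ⟨[1, -1, 1, 1, 1, 1, -1, 1], [1, 2, 2, 4, 3, 2, 1], [4, 2, 5, 6, 7, 4, 3, 1, 5, 4, 6, 5, 2, 4, 3, 4, 2, 5, 6, 4, 5, 1, 3, 4, 7, 6, 5, 2, 4]⟩,
   ⟨[-1, 1, 1, 1, 1, 1, -1, 1], [1, 2, 3, 4, 3, 2, 1], [3, 4, 2, 5, 6, 7, 4, 3, 1, 5, 4, 6, 5, 2, 4, 3, 4, 2, 5, 6, 4, 5, 1, 3, 4, 7, 6, 5, 2, 4, 3]⟩,
   ⟨[0, 0, 0, 0, 0, 0, -2, 2], [2, 2, 3, 4, 3, 2, 1], [1, 3, 4, 2, 5, 6, 7, 4, 3, 1, 5, 4, 6, 5, 2, 4, 3, 4, 2, 5, 6, 4, 5, 1, 3, 4, 7, 6, 5, 2, 4, 3, 1]⟩]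

/-- The table of type `E_7`. -/
def tableE7 : List Row := tableE6 ++ rowsE7

/-- The first rows that type `E_8` adds to those of type `E_7`. -/
def rowsE8a : List Row :=
  [
   ⟨[0, 0, 0, 0, 0, -2, 2, 0], [0, 0, 0, 0, 0, 0, 0, 1], [8]⟩,
   ⟨[0, 0, 0, 0, -2, 0, 2, 0], [0, 0, 0, 0, 0, 0, 1, 1], [8, 7, 8]⟩,
   ⟨[0, 0, 0, -2, 0, 0, 2, 0], [0, 0, 0, 0, 0, 1, 1, 1], [8, 7, 6, 7, 8]⟩,
   ⟨[0, 0, -2, 0, 0, 0, 2, 0], [0, 0, 0, 0, 1, 1, 1, 1], [8, 7, 6, 5, 6, 7, 8]⟩,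
   ⟨[0, -2, 0, 0, 0, 0, 2, 0], [0, 0, 0, 1, 1, 1, 1, 1], [8, 7, 6, 5, 4, 5, 6, 7, 8]⟩,
   ⟨[-2, 0, 0, 0, 0, 0, 2, 0], [0, 0, 1, 1, 1, 1, 1, 1], [8, 7, 6, 5, 4, 3, 4, 5, 6, 7, 8]⟩,
   ⟨[2, 0, 0, 0, 0, 0, 2, 0], [0, 1, 0, 1, 1, 1, 1, 1], [8, 7, 6, 5, 4, 2, 4, 5, 6, 7, 8]⟩,
   ⟨[0, 2, 0, 0, 0, 0, 2, 0], [0, 1, 1, 1, 1, 1, 1, 1], [8, 7, 6, 5, 2, 4, 3, 4, 2, 5, 6, 7, 8]⟩,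
   ⟨[0, 0, 2, 0, 0, 0, 2, 0], [0, 1, 1, 2, 1, 1, 1, 1], [4, 8, 7, 6, 5, 2, 4, 3, 4, 2, 5, 6, 7, 8, 4]⟩,
   ⟨[0, 0, 0, 2, 0, 0, 2, 0], [0, 1, 1, 2, 2, 1, 1, 1], [5, 4, 8, 7, 6, 5, 2, 4, 3, 4, 2, 5, 6, 7, 8, 4, 5]⟩,
   ⟨[0, 0, 0, 0, 2, 0, 2, 0], [0, 1, 1, 2, 2, 2, 1, 1], [6, 5, 4, 8, 7, 6, 5, 2, 4, 3, 4, 2, 5, 6, 7, 8, 4, 5, 6]⟩,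
   ⟨[0, 0, 0, 0, 0, 2, 2, 0], [0, 1, 1, 2, 2, 2, 2, 1], [7, 6, 5, 4, 8, 7, 6, 5, 2, 4, 3, 4, 2, 5, 6, 7, 8, 4, 5, 6, 7]⟩,
   ⟨[-1, -1, -1, -1, -1, -1, 1, 1], [1, 0, 1, 1, 1, 1, 1, 1], [1, 3, 4, 5, 6, 7, 8, 7, 6, 5, 4, 3, 1]⟩]

/-- The word `s_θ = s_1 s_6 s_5 s_2 s_4 s_3 s_4 s_2 s_5 s_6 s_1`. -/
def thetaWord : List ℕ := [1, 6, 5, 2, 4, 3, 4, 2, 5, 6, 1]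

/-- A row whose reflection is `w s_θ w⁻¹`. -/
def thetaConj (coords : List ℤ) (coeffs w : List ℕ) : Row :=
  ⟨coords, coeffs, w ++ thetaWord ++ w.reverse⟩

/-- The remaining rows of type `E_8`, given through the conjugating words `w`. -/
def rowsE8b : List Row :=
  [
   thetaConj [1, 1, -1, -1, -1, -1, 1, 1] [1, 1, 1, 1, 1, 1, 1, 1] [8, 7],
   thetaConj [1, -1, 1, -1, -1, -1, 1, 1] [1, 1, 1, 2, 1, 1, 1, 1] [4, 8, 7],
   thetaConj [-1, 1, 1, -1, -1, -1, 1, 1] [1, 1, 2, 2, 1, 1, 1, 1] [3, 4, 8, 7],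
   thetaConj [-1, 1, -1, 1, -1, -1, 1, 1] [1, 1, 2, 2, 2, 1, 1, 1] [5, 3, 4, 8, 7],
   thetaConj [-1, -1, 1, 1, -1, -1, 1, 1] [1, 1, 2, 3, 2, 1, 1, 1] [4, 5, 3, 4, 8, 7],
   thetaConj [1, 1, 1, 1, -1, -1, 1, 1] [1, 2, 2, 3, 2, 1, 1, 1] [2, 4, 5, 3, 4, 8, 7],
   thetaConj [1, 1, 1, -1, 1, -1, 1, 1] [1, 2, 2, 3, 2, 2, 1, 1] [6, 2, 4, 5, 3, 4, 8, 7],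
   thetaConj [1, -1, -1, 1, -1, -1, 1, 1] [1, 1, 1, 2, 2, 1, 1, 1] [5, 4, 8, 7],
   thetaConj [1, -1, -1, -1, 1, -1, 1, 1] [1, 1, 1, 2, 2, 2, 1, 1] [6, 5, 4, 8, 7],
   thetaConj [-1, 1, -1, -1, 1, -1, 1, 1] [1, 1, 2, 2, 2, 2, 1, 1] [3, 6, 5, 4, 8, 7],
   thetaConj [-1, -1, 1, -1, 1, -1, 1, 1] [1, 1, 2, 3, 2, 2, 1, 1] [4, 3, 6, 5, 4, 8, 7],
   thetaConj [-1, -1, -1, 1, 1, -1, 1, 1] [1, 1, 2, 3, 3, 2, 1, 1] [5, 4, 3, 6, 5, 4, 8, 7],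
   thetaConj [1, 1, -1, 1, 1, -1, 1, 1] [1, 2, 2, 3, 3, 2, 1, 1] [2, 5, 4, 3, 6, 5, 4, 8, 7],
   thetaConj [1, -1, 1, 1, 1, -1, 1, 1] [1, 2, 2, 4, 3, 2, 1, 1] [4, 2, 5, 4, 3, 6, 5, 4, 8, 7],
   thetaConj [-1, 1, 1, 1, 1, -1, 1, 1] [1, 2, 3, 4, 3, 2, 1, 1] [3, 4, 2, 5, 4, 3, 6, 5, 4, 8, 7],
   thetaConj [0, 0, 0, 0, 0, -2, 0, 2] [2, 2, 3, 4, 3, 2, 1, 1] [1, 3, 4, 2, 5, 4, 3, 6, 5, 4, 8, 7],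
   thetaConj [1, -1, -1, -1, -1, 1, 1, 1] [1, 1, 1, 2, 2, 2, 2, 1] [7, 6, 5, 4, 8, 7],
   thetaConj [-1, 1, -1, -1, -1, 1, 1, 1] [1, 1, 2, 2, 2, 2, 2, 1] [3, 7, 6, 5, 4, 8, 7],
   thetaConj [-1, -1, 1, -1, -1, 1, 1, 1] [1, 1, 2, 3, 2, 2, 2, 1] [4, 3, 7, 6, 5, 4, 8, 7],
   thetaConj [1, 1, 1, -1, -1, 1, 1, 1] [1, 2, 2, 3, 2, 2, 2, 1] [2, 4, 3, 7, 6, 5, 4, 8, 7],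
   thetaConj [1, 1, -1, 1, -1, 1, 1, 1] [1, 2, 2, 3, 3, 2, 2, 1] [5, 2, 4, 3, 7, 6, 5, 4, 8, 7],
   thetaConj [1, -1, 1, 1, -1, 1, 1, 1] [1, 2, 2, 4, 3, 2, 2, 1] [4, 5, 2, 4, 3, 7, 6, 5, 4, 8, 7],
   thetaConj [-1, 1, 1, 1, -1, 1, 1, 1] [1, 2, 3, 4, 3, 2, 2, 1] [3, 4, 5, 2, 4, 3, 7, 6, 5, 4, 8, 7],
   thetaConj [0, 0, 0, 0, -2, 0, 0, 2] [2, 2, 3, 4, 3, 2, 2, 1] [1, 3, 4, 5, 2, 4, 3, 7, 6, 5, 4, 8, 7],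
   thetaConj [-1, -1, -1, 1, -1, 1, 1, 1] [1, 1, 2, 3, 3, 2, 2, 1] [5, 4, 3, 7, 6, 5, 4, 8, 7],
   thetaConj [-1, -1, -1, -1, 1, 1, 1, 1] [1, 1, 2, 3, 3, 3, 2, 1] [6, 5, 4, 3, 7, 6, 5, 4, 8, 7],
   thetaConj [1, 1, -1, -1, 1, 1, 1, 1] [1, 2, 2, 3, 3, 3, 2, 1] [2, 6, 5, 4, 3, 7, 6, 5, 4, 8, 7],
   thetaConj [1, -1, 1, -1, 1, 1, 1, 1] [1, 2, 2, 4, 3, 3, 2, 1] [4, 2, 6, 5, 4, 3, 7, 6, 5, 4, 8, 7],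
   thetaConj [-1, 1, 1, -1, 1, 1, 1, 1] [1, 2, 3, 4, 3, 3, 2, 1] [3, 4, 2, 6, 5, 4, 3, 7, 6, 5, 4, 8, 7],
   thetaConj [0, 0, 0, -2, 0, 0, 0, 2] [2, 2, 3, 4, 3, 3, 2, 1] [1, 3, 4, 2, 6, 5, 4, 3, 7, 6, 5, 4, 8, 7],
   thetaConj [0, 0, -2, 0, 0, 0, 0, 2] [2, 2, 3, 4, 4, 3, 2, 1] [5, 1, 3, 4, 2, 6, 5, 4, 3, 7, 6, 5, 4, 8, 7],
   thetaConj [0, -2, 0, 0, 0, 0, 0, 2] [2, 2, 3, 5, 4, 3, 2, 1] [4, 5, 1, 3, 4, 2, 6, 5, 4, 3, 7, 6, 5, 4, 8, 7],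
   thetaConj [-2, 0, 0, 0, 0, 0, 0, 2] [2, 2, 4, 5, 4, 3, 2, 1] [3, 4, 5, 1, 3, 4, 2, 6, 5, 4, 3, 7, 6, 5, 4, 8, 7],
   thetaConj [1, -1, -1, 1, 1, 1, 1, 1] [1, 2, 2, 4, 4, 3, 2, 1] [5, 4, 2, 6, 5, 4, 3, 7, 6, 5, 4, 8, 7],
   thetaConj [-1, 1, -1, 1, 1, 1, 1, 1] [1, 2, 3, 4, 4, 3, 2, 1] [3, 5, 4, 2, 6, 5, 4, 3, 7, 6, 5, 4, 8, 7],
   thetaConj [-1, -1, 1, 1, 1, 1, 1, 1] [1, 2, 3, 5, 4, 3, 2, 1] [4, 3, 5, 4, 2, 6, 5, 4, 3, 7, 6, 5, 4, 8, 7],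
   thetaConj [1, 1, 1, 1, 1, 1, 1, 1] [1, 3, 3, 5, 4, 3, 2, 1] [2, 4, 3, 5, 4, 2, 6, 5, 4, 3, 7, 6, 5, 4, 8, 7],
   thetaConj [2, 0, 0, 0, 0, 0, 0, 2] [2, 3, 3, 5, 4, 3, 2, 1] [1, 2, 4, 3, 5, 4, 2, 6, 5, 4, 3, 7, 6, 5, 4, 8, 7],
   thetaConj [0, 2, 0, 0, 0, 0, 0, 2] [2, 3, 4, 5, 4, 3, 2, 1] [3, 1, 2, 4, 3, 5, 4, 2, 6, 5, 4, 3, 7, 6, 5, 4, 8, 7],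
   thetaConj [0, 0, 2, 0, 0, 0, 0, 2] [2, 3, 4, 6, 4, 3, 2, 1] [4, 3, 1, 2, 4, 3, 5, 4, 2, 6, 5, 4, 3, 7, 6, 5, 4, 8, 7],
   thetaConj [0, 0, 0, 2, 0, 0, 0, 2] [2, 3, 4, 6, 5, 3, 2, 1] [5, 4, 3, 1, 2, 4, 3, 5, 4, 2, 6, 5, 4, 3, 7, 6, 5, 4, 8, 7],
   thetaConj [0, 0, 0, 0, 2, 0, 0, 2] [2, 3, 4, 6, 5, 4, 2, 1] [6, 5, 4, 3, 1, 2, 4, 3, 5, 4, 2, 6, 5, 4, 3, 7, 6, 5, 4, 8, 7],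
   thetaConj [0, 0, 0, 0, 0, 2, 0, 2] [2, 3, 4, 6, 5, 4, 3, 1] [7, 6, 5, 4, 3, 1, 2, 4, 3, 5, 4, 2, 6, 5, 4, 3, 7, 6, 5, 4, 8, 7],
   thetaConj [0, 0, 0, 0, 0, 0, 2, 2] [2, 3, 4, 6, 5, 4, 3, 2] [8, 7, 6, 5, 4, 3, 1, 2, 4, 3, 5, 4, 2, 6, 5, 4, 3, 7, 6, 5, 4, 8, 7]]

/-- The table of type `E_8`. -/
def tableE8 : List Row := tableE7 ++ rowsE8a ++ rowsE8b

end WeylWords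

end

open WeylWords

open scoped RealInnerProductSpace

noncomputable section

namespace WeylWords

section

variable {d n : ℕ} {α : ℕ → Vec d}

/-! ### Reflections -/

/-! Each palindrome is read from its middle letter outwards (`Chain`). Adding a letter `k` at both
ends replaces the root `γ` by `s_k γ` and conjugates `s_γ` by `s_k`. The steps used all satisfy `⟪γ,
α_k⟫ < 0`. Such a step adds a positive multiple of `α_k` to `γ`, so the root stays positive
(`Chain.mem_posRoots`), and it adds exactly two inversions to the reflection
(`ncard_inversions_conj`). Hence the length of the word equals the number of inversions. Since a
word has at least as many letters as its product has inversions (`ncard_inversions_wordProd_le`),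
the palindrome is reduced.

No classification of root systems is needed for completeness. Let `P` be the set of listed roots. If
`P` contains the simple roots and each `s_k` maps `P` minus `α_k` into `P`, then `P ∪ -P` is stable
under the Weyl group and so contains every root. A vector `ρ` with positive inner product with the
simple roots separates `P` from `-P`, so `P` is exactly the set of positive roots (`posRoots_eq`). A
positive root is determined by its reflection (`hypRefl_injOn`), which gives the bijection with the
set of reflections. `isReflectionTable_of_chain` collects these facts.

In the simply laced types every step has `⟪γ, α_k⟫ = -1` and all roots have squared length 2. A step
then adds `α_k` once, so the height grows by one while the length grows by two
(`Chain.exists_corootHeight`).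

It remains to produce the chains and to check closure. In the classical types the chains come from
moving one index along the basis vectors (`Chain.shift`), and closure from the action of the `s_k`
by signed transpositions. In the exceptional types both are finite computations with integer lists
(`TableCheck`). -/

lemma hypRefl_apply (v x : Vec d) : hypRefl v x = x - (2 * ⟪v, x⟫ / ⟪v, v⟫) • v := by
  rw [hypRefl, Submodule.reflection_orthogonal_apply, Submodule.reflection_singleton_apply,
    neg_sub, real_inner_self_eq_norm_sq]
  simp only [RCLike.ofReal_real_eq_id, id_eq, two_smul, ← add_smul]
  congr 2
  ring

lemma hypRefl_self (v : Vec d) : hypRefl v v = -v :=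
  Submodule.reflection_orthogonalComplement_singleton_eq_neg v

lemma hypRefl_hypRefl (v x : Vec d) : hypRefl v (hypRefl v x) = x :=
  Submodule.reflection_reflection _ x

lemma hypRefl_mul_self (v : Vec d) : hypRefl v * hypRefl v = 1 := by
  ext1 x
  exact hypRefl_hypRefl v x

lemma hypRefl_inv (v : Vec d) : (hypRefl v)⁻¹ = hypRefl v :=
  inv_eq_of_mul_eq_one_left (hypRefl_mul_self v)

lemma hypRefl_neg (v : Vec d) : hypRefl (-v) = hypRefl v := by
  ext1 x
  simp only [hypRefl_apply, inner_neg_left, inner_neg_right, neg_neg, smul_neg, mul_neg, neg_div,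
    neg_smul]

lemma hypRefl_map (w : Vec d ≃ₗᵢ[ℝ] Vec d) (v : Vec d) :
    hypRefl (w v) = w * hypRefl v * w⁻¹ := by
  ext1 x
  obtain ⟨y, rfl⟩ := w.surjective x
  have h : w⁻¹ (w y) = y := w.symm_apply_apply y
  change _ = w (hypRefl v (w⁻¹ (w y)))
  rw [h, hypRefl_apply, hypRefl_apply, map_sub, map_smul, w.inner_map_map, w.inner_map_map]

/-! ### Weyl group and roots -/

lemma hypRefl_mem_weylGroup {k : ℕ} (h1 : 1 ≤ k) (hn : k ≤ n) :
    hypRefl (α k) ∈ weylGroup n α :=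
  Subgroup.subset_closure ⟨k, h1, hn, rfl⟩

lemma simple_mem_roots {k : ℕ} (h1 : 1 ≤ k) (hn : k ≤ n) : α k ∈ roots n α :=
  ⟨1, one_mem _, k, h1, hn, rfl⟩

lemma map_mem_roots {w : Vec d ≃ₗᵢ[ℝ] Vec d} (hw : w ∈ weylGroup n α) {v : Vec d}
    (hv : v ∈ roots n α) : w v ∈ roots n α := by
  obtain ⟨u, hu, k, h1, hn, rfl⟩ := hv
  exact ⟨w * u, mul_mem hw hu, k, h1, hn, rfl⟩

lemma neg_mem_roots {v : Vec d} (hv : v ∈ roots n α) : -v ∈ roots n α := by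
  obtain ⟨u, hu, k, h1, hn, rfl⟩ := hv
  refine ⟨u * hypRefl (α k), mul_mem hu (hypRefl_mem_weylGroup h1 hn), k, h1, hn, ?_⟩
  change _ = u (hypRefl (α k) (α k))
  rw [hypRefl_self, map_neg]

lemma hypRefl_mem_weylGroup_of_mem_roots {v : Vec d} (hv : v ∈ roots n α) :
    hypRefl v ∈ weylGroup n α := by
  obtain ⟨u, hu, k, h1, hn, rfl⟩ := hv
  rw [hypRefl_map]
  exact mul_mem (mul_mem hu (hypRefl_mem_weylGroup h1 hn)) (inv_mem hu)

lemma wordProd_cons (k : ℕ) (l : List ℕ) :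
    wordProd α (k :: l) = hypRefl (α k) * wordProd α l := by simp [wordProd]

lemma wordProd_append (l l' : List ℕ) :
    wordProd α (l ++ l') = wordProd α l * wordProd α l' := by simp [wordProd]

lemma wordProd_singleton (k : ℕ) : wordProd α [k] = hypRefl (α k) := by simp [wordProd]

/-! ### Words built from the middle outwards -/

/-- `Chain n α S β l`: the palindrome `l` is built from its middle letter by adding equal letters
`k` at both ends, while the root `γ` becomes `s_k γ` and `⟪γ, α_k⟫ ∈ S` at each step. -/
inductive Chain (n : ℕ) (α : ℕ → Vec d) (S : Set ℝ) : Vec d → List ℕ → Prop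
  | simple (k : ℕ) : 1 ≤ k → k ≤ n → Chain n α S (α k) [k]
  | step (γ : Vec d) (l : List ℕ) (k : ℕ) : Chain n α S γ l → 1 ≤ k → k ≤ n →
      ⟪γ, α k⟫ ∈ S → Chain n α S (hypRefl (α k) γ) (k :: (l ++ [k]))

namespace Chain

variable {S S' : Set ℝ} {β : Vec d} {l : List ℕ}

/-- Simply laced chains are built once with `S = {-1}`, which the height formula needs, and are
weakened to negative inner products for reducedness. -/
lemma mono (h : Chain n α S β l) (hS : S ⊆ S') : Chain n α S' β l := by
  induction h with
  | simple k h1 hn => exact .simple k h1 hn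
  | step γ l k _ h1 hn hi ih => exact .step γ l k ih h1 hn (hS hi)

lemma isWord (h : Chain n α S β l) : IsWord n l := by
  induction h with
  | simple k h1 hn => simp [IsWord, h1, hn]
  | step γ l k _ h1 hn hi ih =>
    intro j hj
    simp only [List.mem_cons, List.mem_append, List.not_mem_nil, or_false] at hj
    rcases hj with rfl | hj | rfl
    exacts [⟨h1, hn⟩, ih j hj, ⟨h1, hn⟩]

lemma reverse_eq (h : Chain n α S β l) : l.reverse = l := by
  induction h with
  | simple k h1 hn => rfl
  | step γ l k _ h1 hn hi ih => simp [ih]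

lemma wordProd_eq (h : Chain n α S β l) : wordProd α l = hypRefl β := by
  induction h with
  | simple k h1 hn => exact wordProd_singleton k
  | step γ l k _ h1 hn hi ih =>
    rw [wordProd_cons, wordProd_append, ih, wordProd_singleton, hypRefl_map, hypRefl_inv, mul_assoc]

lemma exists_conj (h : Chain n α S β l) :
    ∃ u k, l = u ++ [k] ++ u.reverse ∧ wordProd α u (α k) = β := by
  induction h with
  | simple k h1 hn => exact ⟨[], k, rfl, rfl⟩
  | step γ l k _ h1 hn hi ih =>
    obtain ⟨u, m, rfl, rfl⟩ := ih
    refine ⟨k :: u, m, by simp, ?_⟩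
    rw [wordProd_cons]
    rfl

lemma mem_roots (h : Chain n α S β l) : β ∈ roots n α := by
  induction h with
  | simple k h1 hn => exact simple_mem_roots h1 hn
  | step γ l k _ h1 hn hi ih => exact map_mem_roots (hypRefl_mem_weylGroup h1 hn) ih

lemma mem_posRoots (h : Chain n α (Set.Iio 0) β l) : β ∈ posRoots n α := by
  refine ⟨h.mem_roots, ?_⟩
  induction h with
  | simple k h1 hn =>
    refine ⟨Pi.single k 1, fun j => ?_, ?_⟩
    · by_cases hj : j = k
      · simp [hj]
      · simp [hj]
    · rw [Finset.sum_eq_single k]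
      · simp
      · intro j _ hj
        simp [hj]
      · simp [h1, hn]
  | step γ l k _ h1 hn hi ih =>
    obtain ⟨c, hc, hγ⟩ := ih
    -- The coefficient by which `s_k γ` exceeds `γ` along `α_k`; it is added to the `k`-th
    -- coefficient of `γ`.
    have ht : 0 ≤ -(2 * ⟪α k, γ⟫ / ⟪α k, α k⟫) := by
      rw [real_inner_comm, ← neg_div]
      exact div_nonneg (by linarith [Set.mem_Iio.1 hi]) real_inner_self_nonneg
    refine ⟨c + Pi.single k (-(2 * ⟪α k, γ⟫ / ⟪α k, α k⟫)), fun j => ?_, ?_⟩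
    · by_cases hj : j = k
      · subst hj
        simpa using add_nonneg (hc j) ht
      · simpa [hj] using hc j
    · simp only [Pi.add_apply, add_smul, Finset.sum_add_distrib, ← hγ]
      rw [Finset.sum_eq_single k, Pi.single_eq_same, hypRefl_apply, neg_smul, sub_eq_add_neg]
      · intro j _ hj
        simp [hj]
      · simp [h1, hn]

/-- In a simply laced chain each step adds one to the height and two to the length. -/
lemma exists_corootHeight (hα : ∀ k, 1 ≤ k → k ≤ n → ⟪α k, α k⟫ = 2)
    (h : Chain n α {-1} β l) :
    ∃ t : ℝ, HasCorootHeight n α β t ∧ (l.length : ℝ) = 2 * t - 1 := by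
  have hnorm : ⟪β, β⟫ = 2 := by
    induction h with
    | simple k h1 hn => exact hα k h1 hn
    | step γ l k _ h1 hn hi ih => rw [LinearIsometryEquiv.inner_map_map, ih]
  have hco : ∀ v : Vec d, ⟪v, v⟫ = 2 → coroot v = v := fun v hv => by
    rw [coroot, hv, div_self two_ne_zero, one_smul]
  suffices ∃ c : ℕ → ℝ, β = ∑ k ∈ Finset.Icc 1 n, c k • α k ∧
      (l.length : ℝ) = 2 * (∑ k ∈ Finset.Icc 1 n, c k) - 1 by
    obtain ⟨c, hc, hl⟩ := this
    refine ⟨_, ⟨c, ?_, rfl⟩, hl⟩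
    rw [hco β hnorm, hc]
    refine Finset.sum_congr rfl fun k hk => ?_
    rw [hco _ (hα k (Finset.mem_Icc.1 hk).1 (Finset.mem_Icc.1 hk).2)]
  clear hnorm
  induction h with
  | simple k h1 hn =>
    have hk : k ∈ Finset.Icc 1 n := Finset.mem_Icc.2 ⟨h1, hn⟩
    refine ⟨Pi.single k 1, ?_, ?_⟩
    · rw [Finset.sum_eq_single_of_mem k hk fun j _ hj => by simp [hj]]
      simp
    · rw [Finset.sum_eq_single_of_mem k hk fun j _ hj => by simp [hj]]
      norm_num
  | step γ l k _ h1 hn hi ih =>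
    have hk : k ∈ Finset.Icc 1 n := Finset.mem_Icc.2 ⟨h1, hn⟩
    obtain ⟨c, hc, hl⟩ := ih
    refine ⟨c + Pi.single k 1, ?_, ?_⟩
    · simp only [Pi.add_apply, add_smul, Finset.sum_add_distrib, ← hc]
      rw [Finset.sum_eq_single_of_mem k hk fun j _ hj => by simp [hj], hypRefl_apply,
        real_inner_comm, Set.mem_singleton_iff.1 hi, hα k h1 hn]
      norm_num [sub_eq_add_neg, ← neg_smul]
    · simp only [Pi.add_apply, Finset.sum_add_distrib, List.length_cons, List.length_append,
        List.length_nil]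
      rw [Finset.sum_eq_single_of_mem (f := Pi.single k (1 : ℝ)) k hk fun j _ hj => by simp [hj],
        Pi.single_eq_same]
      push_cast
      rw [hl]
      ring

end Chain

/-! ### Positive systems -/

/-- `P` is a finite set of positive roots, contains the simple roots, and each simple reflection
`s_k` permutes the elements of `P` other than `α_k`. The vector `ρ` lies in the open dominant
chamber. -/
structure IsPositiveSystem (n : ℕ) (α : ℕ → Vec d) (ρ : Vec d) (P : Set (Vec d)) : Prop where
  finite : P.Finite
  simple_mem : ∀ k, 1 ≤ k → k ≤ n → α k ∈ P
  refl_mem : ∀ k, 1 ≤ k → k ≤ n → ∀ v ∈ P, v ≠ α k → hypRefl (α k) v ∈ P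
  subset_posRoots : P ⊆ posRoots n α
  inner_simple_pos : ∀ k, 1 ≤ k → k ≤ n → 0 < ⟪ρ, α k⟫

namespace IsPositiveSystem

variable {ρ : Vec d} {P : Set (Vec d)} {w : Vec d ≃ₗᵢ[ℝ] Vec d}

lemma inner_nonneg (h : IsPositiveSystem n α ρ P) {v : Vec d} (hv : v ∈ posRoots n α) :
    0 ≤ ⟪ρ, v⟫ := by
  obtain ⟨-, c, hc, rfl⟩ := hv
  rw [inner_sum]
  refine Finset.sum_nonneg fun k hk => ?_
  rw [inner_smul_right]
  exact mul_nonneg (hc k) (h.inner_simple_pos k (Finset.mem_Icc.1 hk).1 (Finset.mem_Icc.1 hk).2).le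

lemma ne_zero_of_mem_roots (h : IsPositiveSystem n α ρ P) {v : Vec d} (hv : v ∈ roots n α) :
    v ≠ 0 := by
  obtain ⟨w, -, k, h1, hn, rfl⟩ := hv
  intro h0
  have := h.inner_simple_pos k h1 hn
  rw [(map_eq_zero_iff w w.injective).1 h0, inner_zero_right] at this
  exact lt_irrefl _ this

/-- If the inner product vanished, every coefficient would vanish, because each simple root
contributes a nonnegative term; but a root is not zero. -/
lemma inner_pos (h : IsPositiveSystem n α ρ P) {v : Vec d} (hv : v ∈ posRoots n α) :
    0 < ⟪ρ, v⟫ := by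
  refine lt_of_le_of_ne (h.inner_nonneg hv) fun h0 => h.ne_zero_of_mem_roots hv.1 ?_
  obtain ⟨-, c, hc, rfl⟩ := hv
  rw [inner_sum, eq_comm, Finset.sum_eq_zero_iff_of_nonneg] at h0
  · refine Finset.sum_eq_zero fun k hk => ?_
    have h2 := h0 k hk
    rw [inner_smul_right] at h2
    have h3 := h.inner_simple_pos k (Finset.mem_Icc.1 hk).1 (Finset.mem_Icc.1 hk).2
    rw [(mul_eq_zero.1 h2).resolve_right h3.ne', zero_smul]
  · intro k hk
    rw [inner_smul_right]
    exact mul_nonneg (hc k)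
      (h.inner_simple_pos k (Finset.mem_Icc.1 hk).1 (Finset.mem_Icc.1 hk).2).le

lemma mem_pos (h : IsPositiveSystem n α ρ P) {v : Vec d} (hv : v ∈ P) : 0 < ⟪ρ, v⟫ :=
  h.inner_pos (h.subset_posRoots hv)

lemma neg_notMem (h : IsPositiveSystem n α ρ P) {v : Vec d} (hv : v ∈ P) : -v ∉ P := fun h' => by
  have h1 := h.mem_pos hv
  have h2 := h.mem_pos h'
  rw [inner_neg_right] at h2
  linarith

/-- The only elements of `P ∪ -P` whose sign can change under `s_k` are `±α_k`, and these are
exchanged. -/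
lemma refl_mem_or_neg (h : IsPositiveSystem n α ρ P) {k : ℕ} (h1 : 1 ≤ k) (hn : k ≤ n)
    {v : Vec d} (hv : v ∈ P ∨ -v ∈ P) :
    hypRefl (α k) v ∈ P ∨ -hypRefl (α k) v ∈ P := by
  rcases hv with hv | hv
  · by_cases hk : v = α k
    · right
      rw [hk, hypRefl_self, neg_neg]
      exact h.simple_mem k h1 hn
    · exact .inl (h.refl_mem k h1 hn v hv hk)
  · by_cases hk : -v = α k
    · left
      rw [← neg_neg v, hk, map_neg, hypRefl_self, neg_neg]
      exact h.simple_mem k h1 hn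
    · right
      rw [← map_neg]
      exact h.refl_mem k h1 hn _ hv hk

/-- The equivalence, rather than one implication, lets the closure induction pass to inverses. -/
lemma map_mem_or_neg_iff (h : IsPositiveSystem n α ρ P) (hw : w ∈ weylGroup n α) :
    ∀ v, (w v ∈ P ∨ -w v ∈ P) ↔ (v ∈ P ∨ -v ∈ P) := by
  induction hw using Subgroup.closure_induction with
  | mem s hs =>
    obtain ⟨k, h1, hn, rfl⟩ := hs
    refine fun v => ⟨fun hv => ?_, h.refl_mem_or_neg h1 hn⟩
    simpa only [hypRefl_hypRefl] using h.refl_mem_or_neg h1 hn hv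
  | one => exact fun v => Iff.rfl
  | mul x y _ _ hx hy => exact fun v => (hx (y v)).trans (hy v)
  | inv x _ hx =>
    intro v
    have hv : x (x⁻¹ v) = v := x.apply_symm_apply v
    rw [← hx (x⁻¹ v), hv]

lemma mem_or_neg_of_mem_roots (h : IsPositiveSystem n α ρ P) {v : Vec d} (hv : v ∈ roots n α) :
    v ∈ P ∨ -v ∈ P := by
  obtain ⟨w, hw, k, h1, hn, rfl⟩ := hv
  exact (h.map_mem_or_neg_iff hw _).2 (.inl (h.simple_mem k h1 hn))

lemma posRoots_eq (h : IsPositiveSystem n α ρ P) : posRoots n α = P := by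
  refine Set.Subset.antisymm (fun v hv => ?_) h.subset_posRoots
  refine (h.mem_or_neg_of_mem_roots hv.1).resolve_right fun hv' => ?_
  have h1 := h.mem_pos hv'
  rw [inner_neg_right] at h1
  linarith [h.inner_nonneg hv]

lemma mem_negRoots_iff (h : IsPositiveSystem n α ρ P) {v : Vec d} :
    v ∈ negRoots n α ↔ -v ∈ P := by
  rw [← h.posRoots_eq]
  constructor
  · rintro ⟨hv, c, hc, hvc⟩
    refine ⟨neg_mem_roots hv, -c, fun k => neg_nonneg.2 (hc k), ?_⟩
    rw [hvc]
    simp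
  · rintro ⟨hv, c, hc, hvc⟩
    refine ⟨by simpa using neg_mem_roots hv, -c, fun k => neg_nonpos.2 (hc k), ?_⟩
    rw [← neg_neg v, hvc]
    simp

lemma mem_inversions_iff (h : IsPositiveSystem n α ρ P) {v : Vec d} :
    v ∈ inversions n α w ↔ v ∈ P ∧ -w v ∈ P := by
  rw [inversions, Set.mem_ofPred_eq, h.posRoots_eq, h.mem_negRoots_iff]

lemma finite_inversions (h : IsPositiveSystem n α ρ P) : (inversions n α w).Finite :=
  h.finite.subset fun _ hv => (h.mem_inversions_iff.1 hv).1

/-- Apart from `α_k`, a positive root stays positive under `s_k`, so it is inverted by `w s_k` only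
if its image is inverted by `w`. -/
lemma inversions_mul_subset (h : IsPositiveSystem n α ρ P) {k : ℕ} (h1 : 1 ≤ k) (hn : k ≤ n) :
    inversions n α (w * hypRefl (α k)) ⊆ insert (α k) (hypRefl (α k) '' inversions n α w) := by
  intro v hv
  obtain ⟨hv, hw⟩ := h.mem_inversions_iff.1 hv
  by_cases hk : v = α k
  · exact .inl hk
  · exact .inr ⟨hypRefl (α k) v, h.mem_inversions_iff.2 ⟨h.refl_mem k h1 hn v hv hk, hw⟩,
      hypRefl_hypRefl _ _⟩

lemma ncard_inversions_mul_le (h : IsPositiveSystem n α ρ P) {k : ℕ} (h1 : 1 ≤ k) (hn : k ≤ n) :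
    (inversions n α (w * hypRefl (α k))).ncard ≤ (inversions n α w).ncard + 1 :=
  calc _ ≤ _ := Set.ncard_le_ncard (h.inversions_mul_subset h1 hn)
        ((h.finite_inversions.image _).insert _)
    _ ≤ _ := Set.ncard_insert_le _ _
    _ ≤ _ := Nat.add_le_add_right (Set.ncard_image_le h.finite_inversions) 1

lemma inversions_one (h : IsPositiveSystem n α ρ P) : inversions n α 1 = ∅ := by
  refine Set.eq_empty_of_forall_notMem fun v hv => ?_
  obtain ⟨hv, hw⟩ := h.mem_inversions_iff.1 hv
  exact h.neg_notMem hv hw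

lemma ncard_inversions_wordProd_le (h : IsPositiveSystem n α ρ P) (l : List ℕ)
    (hl : IsWord n l) : (inversions n α (wordProd α l)).ncard ≤ l.length := by
  -- Letters are removed on the right because the counting lemma concerns multiplication by `s_k` on
  -- the right.
  induction l using List.reverseRecOn with
  | nil =>
    have : wordProd α [] = 1 := rfl
    simp [this, h.inversions_one]
  | append_singleton l k ih =>
    rw [wordProd_append, wordProd_singleton, List.length_append]
    have hk := hl k (by simp)
    exact (h.ncard_inversions_mul_le hk.1 hk.2).trans
      (Nat.add_le_add_right (ih fun j hj => hl j (by simp [hj])) 1)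

/-- When `w α_k` is positive, `α_k` is an inversion of `w s_k` but not of `w`, and the inclusion of
`inversions_mul_subset` becomes an equality with a disjoint union. -/
lemma ncard_inversions_mul (h : IsPositiveSystem n α ρ P) {k : ℕ} (h1 : 1 ≤ k) (hn : k ≤ n)
    (hwk : w (α k) ∈ P) :
    (inversions n α (w * hypRefl (α k))).ncard = (inversions n α w).ncard + 1 := by
  have hk := h.simple_mem k h1 hn
  have heq : inversions n α (w * hypRefl (α k)) =
      insert (α k) (hypRefl (α k) '' inversions n α w) := by
    refine Set.Subset.antisymm (h.inversions_mul_subset h1 hn) ?_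
    rintro _ (rfl | ⟨v, hv, rfl⟩) <;> rw [h.mem_inversions_iff]
    · refine ⟨hk, ?_⟩
      change -w (hypRefl (α k) (α k)) ∈ P
      rwa [hypRefl_self, map_neg, neg_neg]
    · obtain ⟨hv, hw⟩ := h.mem_inversions_iff.1 hv
      refine ⟨h.refl_mem k h1 hn v hv ?_, ?_⟩
      · rintro rfl
        exact h.neg_notMem hwk hw
      · change -w (hypRefl (α k) (hypRefl (α k) v)) ∈ P
        rwa [hypRefl_hypRefl]
  rw [heq, Set.ncard_insert_of_notMem _ (h.finite_inversions.image _),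
    Set.ncard_image_of_injective _ (hypRefl (α k)).injective]
  rintro ⟨v, hv, hvk⟩
  have hv' := (h.mem_inversions_iff.1 hv).1
  have : v = -α k := by rw [← hypRefl_hypRefl (α k) v, hvk, hypRefl_self]
  exact h.neg_notMem hk (this ▸ hv')

/-- The map `v ↦ -w⁻¹ v` injects the inversions of `w⁻¹` into those of `w`. -/
lemma ncard_inversions_inv_le (h : IsPositiveSystem n α ρ P) :
    (inversions n α w⁻¹).ncard ≤ (inversions n α w).ncard := by
  refine Set.ncard_le_ncard_of_injOn (fun v => -w⁻¹ v) (fun v hv => ?_) (fun v _ v' _ hvv => ?_)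
    h.finite_inversions
  · obtain ⟨hv, hw⟩ := h.mem_inversions_iff.1 hv
    refine h.mem_inversions_iff.2 ⟨hw, ?_⟩
    have : w (w⁻¹ v) = v := w.apply_symm_apply v
    simpa [this] using hv
  · exact w⁻¹.injective (neg_injective hvv)

lemma ncard_inversions_inv (h : IsPositiveSystem n α ρ P) :
    (inversions n α w⁻¹).ncard = (inversions n α w).ncard :=
  le_antisymm h.ncard_inversions_inv_le (by simpa using h.ncard_inversions_inv_le (w := w⁻¹))

/-- Conjugating `s_γ` by `s_k` adds two inversions if `⟪γ, α_k⟫ < 0`. -/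
lemma ncard_inversions_conj (h : IsPositiveSystem n α ρ P) {k : ℕ} (h1 : 1 ≤ k) (hn : k ≤ n)
    {γ : Vec d} (hγ : γ ∈ P) (hi : ⟪γ, α k⟫ < 0) :
    (inversions n α (hypRefl (hypRefl (α k) γ))).ncard =
      (inversions n α (hypRefl γ)).ncard + 2 := by
  have hγr := (h.subset_posRoots hγ).1
  have hγ0 : 0 < ⟪γ, γ⟫ := real_inner_self_pos.2 (h.ne_zero_of_mem_roots hγr)
  have hs : hypRefl γ (α k) = α k + (-(2 * ⟪γ, α k⟫ / ⟪γ, γ⟫)) • γ := by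
    rw [hypRefl_apply, neg_smul, sub_eq_add_neg]
  have ht : 0 < -(2 * ⟪γ, α k⟫ / ⟪γ, γ⟫) := by
    rw [← neg_div]
    exact div_pos (by linarith) hγ0
  -- The vector `s_γ α_k` is `α_k` plus a positive multiple of `γ`; its inner product with `ρ` is
  -- positive, which excludes the negative sign.
  have hmem : hypRefl γ (α k) ∈ P := by
    refine ((h.map_mem_or_neg_iff (hypRefl_mem_weylGroup_of_mem_roots hγr) _).2
      (.inl (h.simple_mem k h1 hn))).resolve_right fun hneg => ?_
    have := h.mem_pos hneg
    rw [hs, inner_neg_right, inner_add_right, inner_smul_right] at this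
    linarith [mul_pos ht (h.mem_pos hγ), h.inner_simple_pos k h1 hn]
  have hne : hypRefl γ (α k) ≠ α k := by
    rw [hs]
    intro heq
    rcases smul_eq_zero.1 (add_eq_left.1 heq) with h0 | h0
    · exact ht.ne' h0
    · exact h.ne_zero_of_mem_roots hγr h0
  have h2 : (hypRefl (α k) * hypRefl γ) (α k) ∈ P := h.refl_mem k h1 hn _ hmem hne
  -- The right factor of `s_k s_γ s_k` accounts for one inversion since `s_k s_γ α_k` is positive.
  -- Passing to the inverse turns `s_k s_γ` into `s_γ s_k`, whose right factor accounts for the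
  -- other.
  rw [hypRefl_map, hypRefl_inv, h.ncard_inversions_mul h1 hn h2, ← h.ncard_inversions_inv,
    mul_inv_rev, hypRefl_inv, hypRefl_inv, h.ncard_inversions_mul h1 hn hmem]

lemma length_eq (h : IsPositiveSystem n α ρ P) {β : Vec d} {l : List ℕ}
    (hl : Chain n α (Set.Iio 0) β l) : l.length = (inversions n α (hypRefl β)).ncard := by
  induction hl with
  | simple k h1 hn =>
    have := h.ncard_inversions_mul (w := 1) h1 hn (h.simple_mem k h1 hn)
    rw [one_mul, h.inversions_one, Set.ncard_empty] at this
    simp [this]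
  | step γ l k hl h1 hn hi ih =>
    rw [h.ncard_inversions_conj h1 hn (h.posRoots_eq ▸ hl.mem_posRoots) hi, ← ih]
    simp

lemma isPalindromicReduced (h : IsPositiveSystem n α ρ P) {β : Vec d} {l : List ℕ}
    (hl : Chain n α (Set.Iio 0) β l) : IsPalindromicReduced n α β l where
  palindrome := hl.reverse_eq
  reduced := by
    refine ⟨hl.isWord, fun l' hl' heq => ?_⟩
    rw [h.length_eq hl, ← hl.wordProd_eq, ← heq]
    exact h.ncard_inversions_wordProd_le l' hl'
  prod_eq := hl.wordProd_eq
  conj := hl.exists_conj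
  length_eq := h.length_eq hl

/-! ### Roots versus reflections, and the assembly of a table. -/

lemma eq_simple_of_hypRefl_eq (h : IsPositiveSystem n α ρ P) {k : ℕ} (h1 : 1 ≤ k) (hn : k ≤ n)
    {γ : Vec d} (hγ : γ ∈ P) (heq : hypRefl γ = hypRefl (α k)) : γ = α k := by
  by_contra hne
  have := h.refl_mem k h1 hn γ hγ hne
  -- Otherwise `s_k γ` is positive, yet it equals `s_γ γ = -γ`.
  rw [← heq, hypRefl_self] at this
  exact h.neg_notMem hγ this

/-- Conjugation by `w⁻¹`, where `β = w α_k`, reduces to a simple reflection: `w⁻¹ γ` is then `±α_k`,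
and the minus sign would give `β = -γ`. -/
lemma hypRefl_injOn (h : IsPositiveSystem n α ρ P) : Set.InjOn hypRefl P := by
  intro β hβ γ hγ heq
  obtain ⟨w, hw, k, h1, hn, rfl⟩ := (h.subset_posRoots hβ).1
  have hwγ : w (w⁻¹ γ) = γ := w.apply_symm_apply γ
  have heq' : hypRefl (w⁻¹ γ) = hypRefl (α k) := by
    rw [hypRefl_map, ← heq, hypRefl_map]
    group
  rcases (h.map_mem_or_neg_iff (inv_mem hw) γ).2 (.inl hγ) with h' | h'
  · rw [← h.eq_simple_of_hypRefl_eq h1 hn h' heq', hwγ]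
  · have := h.eq_simple_of_hypRefl_eq h1 hn h' (by rw [hypRefl_neg, heq'])
    rw [← this, map_neg, hwγ] at hβ
    exact absurd hβ (h.neg_notMem hγ)

lemma isReflectionTable (h : IsPositiveSystem n α ρ P) {ι : Type} {I : Set ι} {root : ι → Vec d}
    {word : ι → List ℕ} (hP : root '' I = P) (hinj : Set.InjOn root I)
    (hchain : ∀ x ∈ I, Chain n α (Set.Iio 0) (root x) (word x)) :
    IsReflectionTable n α I root word where
  expr x hx := h.isPalindromicReduced (hchain x hx)
  bijOn_posRoots := by
    rw [h.posRoots_eq, ← hP]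
    exact hinj.bijOn_image
  bijOn_reflections := by
    refine ⟨fun x hx => ?_, fun x hx y hy hxy => ?_, ?_⟩
    · obtain ⟨w, hw, k, h1, hn, hwk⟩ := (hchain x hx).mem_roots
      refine ⟨w, hw, k, h1, hn, ?_⟩
      simp only [(hchain x hx).wordProd_eq, hwk, hypRefl_map]
    · simp only [(hchain x hx).wordProd_eq, (hchain y hy).wordProd_eq] at hxy
      exact hinj hx hy (h.hypRefl_injOn (hP ▸ ⟨x, hx, rfl⟩) (hP ▸ ⟨y, hy, rfl⟩) hxy)
    · rintro _ ⟨w, hw, k, h1, hn, rfl⟩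
      rw [← hypRefl_map]
      -- A conjugate of `s_k` is the reflection in `w α_k`. This root is listed up to sign, and the
      -- sign does not affect the reflection.
      rcases (h.map_mem_or_neg_iff hw _).2 (.inl (h.simple_mem k h1 hn)) with h' | h' <;>
        obtain ⟨x, hx, hxw⟩ := hP.symm ▸ h' <;> refine ⟨x, hx, ?_⟩ <;>
        simp only [(hchain x hx).wordProd_eq, hxw, hypRefl_neg]

end IsPositiveSystem

/-- A family of chains whose roots contain the simple roots, and are permuted by each simple
reflection up to the sign of its own root, is a reflection table. -/
theorem isReflectionTable_of_chain {ι : Type} {I : Set ι} {root : ι → Vec d} {word : ι → List ℕ}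
    (ρ : Vec d) (hρ : ∀ k, 1 ≤ k → k ≤ n → 0 < ⟪ρ, α k⟫)
    (hfin : I.Finite) (hinj : Set.InjOn root I)
    (hchain : ∀ x ∈ I, Chain n α (Set.Iio 0) (root x) (word x))
    (hsimple : ∀ k, 1 ≤ k → k ≤ n → α k ∈ root '' I)
    (hrefl : ∀ k, 1 ≤ k → k ≤ n → ∀ x ∈ I, root x = α k ∨ hypRefl (α k) (root x) ∈ root '' I) :
    IsReflectionTable n α I root word := by
  refine IsPositiveSystem.isReflectionTable (ρ := ρ)
    { finite := hfin.image root
      simple_mem := hsimple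
      refl_mem := ?_
      subset_posRoots := ?_
      inner_simple_pos := hρ } rfl hinj hchain
  · rintro k h1 hn _ ⟨x, hx, rfl⟩ hne
    exact (hrefl k h1 hn x hx).resolve_left hne
  · rintro _ ⟨x, hx, rfl⟩
    exact (hchain x hx).mem_posRoots

end

/-! ### Standard basis vectors and the classical types -/

lemma e_apply (d i : ℕ) (k : Fin d) : e d i k = if (k : ℕ) + 1 = i then 1 else 0 := rfl

lemma inner_e {d i : ℕ} (h1 : 1 ≤ i) (hd : i ≤ d) (v : Vec d) :
    ⟪v, e d i⟫ = v ⟨i - 1, by omega⟩ := by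
  rw [PiLp.inner_apply, Finset.sum_eq_single ⟨i - 1, by omega⟩]
  · simp [e_apply, Nat.sub_add_cancel h1]
  · intro k _ hk
    have : (k : ℕ) + 1 ≠ i := fun h => hk (Fin.ext (by simp; omega))
    simp [e_apply, this]
  · simp

lemma inner_e_e {d j : ℕ} (h1 : 1 ≤ j) (hd : j ≤ d) (i : ℕ) :
    ⟪e d i, e d j⟫ = if i = j then 1 else 0 := by
  rw [inner_e h1 hd, e_apply]
  simp only [Nat.sub_add_cancel h1, eq_comm]

/-- The vector `(d, d - 1, …, 1)`. -/
def descending (d : ℕ) : Vec d := WithLp.toLp 2 fun k => (d : ℝ) - (k : ℕ)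

lemma inner_descending {d i : ℕ} (h1 : 1 ≤ i) (hd : i ≤ d) :
    ⟪descending d, e d i⟫ = d + 1 - i := by
  rw [inner_e h1 hd]
  simp only [descending, Nat.cast_sub h1]
  push_cast
  ring

/-! ### Reflections acting on basis vectors by signed transpositions. -/

lemma hypRefl_smul {d : ℕ} {a : ℝ} (ha : a ≠ 0) (v : Vec d) : hypRefl (a • v) = hypRefl v := by
  ext1 x
  simp only [hypRefl_apply, inner_smul_left, inner_smul_right, conj_trivial, smul_smul]
  congr 2
  -- For `v = 0` the quotients are divisions by zero, so this case is separated before clearing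
  -- denominators.
  by_cases hv : ⟪v, v⟫ = 0
  · simp [inner_self_eq_zero.1 hv]
  · field_simp

lemma hypRefl_e {d i : ℕ} (hi : 1 ≤ i) (hid : i ≤ d) (k : ℕ) :
    hypRefl (e d i) (e d k) = if k = i then -e d k else e d k := by
  split_ifs with h
  · rw [h, hypRefl_self]
  · rw [hypRefl_apply, real_inner_comm, inner_e_e hi hid, if_neg h]
    simp

lemma inner_sub_self {d i j : ℕ} (hi : 1 ≤ i) (hid : i ≤ d) (hj : 1 ≤ j) (hjd : j ≤ d)
    (hij : i ≠ j) : ⟪e d i - e d j, e d i - e d j⟫ = 2 := by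
  simp only [inner_sub_left, inner_sub_right, inner_e_e hi hid, inner_e_e hj hjd, hij, hij.symm]
  norm_num

lemma inner_add_self {d i j : ℕ} (hi : 1 ≤ i) (hid : i ≤ d) (hj : 1 ≤ j) (hjd : j ≤ d)
    (hij : i ≠ j) : ⟪e d i + e d j, e d i + e d j⟫ = 2 := by
  simp only [inner_add_left, inner_add_right, inner_e_e hi hid, inner_e_e hj hjd, hij, hij.symm]
  norm_num

lemma hypRefl_sub_e {d i j : ℕ} (hi : 1 ≤ i) (hid : i ≤ d) (hj : 1 ≤ j) (hjd : j ≤ d)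
    (hij : i ≠ j) (k : ℕ) : hypRefl (e d i - e d j) (e d k) =
      e d (if k = i then j else if k = j then i else k) := by
  rw [hypRefl_apply, inner_sub_self hi hid hj hjd hij, real_inner_comm, inner_sub_right,
    inner_e_e hi hid, inner_e_e hj hjd]
  split_ifs with h h' h'
  · omega
  · subst h
    simp
  · subst h'
    norm_num
  · simp

lemma hypRefl_add_e {d i j : ℕ} (hi : 1 ≤ i) (hid : i ≤ d) (hj : 1 ≤ j) (hjd : j ≤ d)
    (hij : i ≠ j) (k : ℕ) : hypRefl (e d i + e d j) (e d k) =
      if k = i then -e d j else if k = j then -e d i else e d k := by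
  rw [hypRefl_apply, inner_add_self hi hid hj hjd hij, real_inner_comm, inner_add_right,
    inner_e_e hi hid, inner_e_e hj hjd]
  split_ifs with h h' h'
  · omega
  · subst h
    simp
  · subst h'
    simp
  · simp

/-- Reflecting in `s_{m-1}, …, s_i` moves `e_m` to `e_i`. -/
lemma Chain.shift {d n m i : ℕ} {α : ℕ → Vec d} {S : Set ℝ} {a : ℝ} {c : Vec d} {l : List ℕ}
    (ha : -a ∈ S) (hi : 1 ≤ i) (him : i ≤ m) (hmn : m ≤ n + 1) (hmd : m ≤ d)
    (hα : ∀ k, i ≤ k → k < m → α k = e d k - e d (k + 1))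
    (hc : ∀ k, i ≤ k → k ≤ m → ⟪c, e d k⟫ = 0) (h : Chain n α S (a • e d m + c) l) :
    Chain n α S (a • e d i + c) (List.Ico i m ++ l ++ (List.Ico i m).reverse) := by
  obtain ⟨t, rfl⟩ := Nat.exists_eq_add_of_le him
  clear him
  induction t generalizing i with
  | zero => simpa using h
  | succ t ih =>
    have h' : i + 1 + t = i + (t + 1) := by omega
    -- The inner word moves `e_m` to `e_{i+1}`; the letter `i` is the outermost one and makes the
    -- last move.
    have hs := ih (i := i + 1) (by omega) (by omega) (by omega) (fun k h1 h2 => hα k (by omega)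
      (by omega)) (fun k h1 h2 => hc k (by omega) (by omega)) (by rwa [h'])
    rw [h'] at hs
    have hci := hc i le_rfl (by omega)
    have hci' := hc (i + 1) (by omega) (by omega)
    have hαi := hα i le_rfl (by omega)
    -- Since `c` is orthogonal to `e_i` and `e_{i+1}`, the inner product with `α_i` is exactly `-a`.
    have := hs.step _ _ i hi (by omega) (by
      rw [hαi, inner_add_left, inner_smul_left, inner_sub_right, inner_sub_right, hci, hci',
        inner_e_e hi (by omega), inner_e_e (by omega) (by omega)]
      simpa using ha)
    have hrefl : hypRefl (α i) (a • e d (i + 1) + c) = a • e d i + c := by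
      rw [hαi, map_add, map_smul, hypRefl_sub_e hi (by omega) (by omega) (by omega) (by omega),
        hypRefl_apply _ c, real_inner_comm, inner_sub_right, hci, hci']
      simp
    rw [hrefl] at this
    rw [List.Ico.eq_cons (by omega)]
    simpa using this

/-- The chain starts at `α_{j-1} = e_{j-1} - e_j` and shifts `e_{j-1}` down to `e_i` while `-e_j` is
held fixed. -/
lemma chain_diff {d n i j : ℕ} {α : ℕ → Vec d} (hi : 1 ≤ i) (hij : i < j) (hjn : j ≤ n + 1)
    (hjd : j ≤ d) (hα : ∀ k, i ≤ k → k < j → α k = e d k - e d (k + 1)) :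
    Chain n α {-1} (e d i - e d j)
      (List.Ico i (j - 1) ++ [j - 1] ++ (List.Ico i (j - 1)).reverse) := by
  have hbase := Chain.simple (α := α) (S := {-1}) (n := n) (j - 1) (by omega) (by omega)
  have h := Chain.shift (a := 1) (c := -e d j) (m := j - 1) (i := i) (n := n) (α := α) (S := {-1})
    (l := [j - 1]) rfl hi (by omega) (by omega) (by omega) (fun k h1 h2 => hα k h1 (by omega))
    (fun k h1 h2 => by
      rw [inner_neg_left, inner_e_e (by omega) (by omega), if_neg (by omega), neg_zero])
    (by
      rw [hα (j - 1) (by omega) (by omega), Nat.sub_add_cancel (by omega)] at hbase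
      simpa [sub_eq_add_neg] using hbase)
  simpa [sub_eq_add_neg] using h

/-! #### Type `A` -/

lemma chain_A {n : ℕ} {p : ℕ × ℕ} (hp : p ∈ labelsA n) :
    Chain n (simpleA n) {-1} (rootA n p) (wordA p) := by
  obtain ⟨h1, h2, h3⟩ := hp
  simpa [rootA, wordA] using chain_diff (n := n) (d := n + 1) (α := simpleA n) (i := p.1)
    (j := p.2 + 1) h1 (by omega) (by omega) (by omega) fun k _ _ => rfl

lemma rootA_injOn (n : ℕ) : Set.InjOn (rootA n) (labelsA n) := by
  rintro ⟨i, j⟩ ⟨h1, h2, h3⟩ ⟨i', j'⟩ ⟨h1', h2', h3'⟩ h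
  dsimp only at h1 h2 h3 h1' h2' h3'
  have key : ∀ k, 1 ≤ k → k ≤ n + 1 → ⟪rootA n (i, j), e (n + 1) k⟫ =
    ⟪rootA n (i', j'), e (n + 1) k⟫ := fun k _ _ => by rw [h]
  -- The coordinate `+1` locates `i`, and the coordinate `-1` locates `j + 1`.
  have a1 := key i (by omega) (by omega)
  have a2 := key (j + 1) (by omega) (by omega)
  simp only [rootA, inner_sub_left] at a1 a2
  rw [inner_e_e (by omega) (by omega), inner_e_e (by omega) (by omega),
    inner_e_e (by omega) (by omega), inner_e_e (by omega) (by omega)] at a1 a2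
  have : i = i' ∧ j = j' := by grind
  simp [this.1, this.2]

theorem isReflectionTable_A (n : ℕ) :
    IsReflectionTable n (simpleA n) (labelsA n) (rootA n) wordA := by
  refine isReflectionTable_of_chain (descending (n + 1)) (fun k h1 hn => ?_) ?_ (rootA_injOn n)
    (fun x hx => (chain_A hx).mono (by simp)) (fun k h1 hn => ?_) (fun k h1 hn x hx => ?_)
  · rw [simpleA, inner_sub_right, inner_descending h1 (by omega),
      inner_descending (by omega) (by omega)]
    push_cast
    linarith
  · refine ((Set.finite_Iic n).prod (Set.finite_Iic n)).subset fun p hp => ?_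
    exact ⟨hp.2.1.trans hp.2.2, hp.2.2⟩
  · exact ⟨(k, k), ⟨h1, le_rfl, hn⟩, rfl⟩
  · obtain ⟨i, j⟩ := x
    obtain ⟨hi, hij, hj⟩ := hx
    dsimp only at hi hij hj
    -- The simple reflection transposes `k` and `k + 1`. This reverses the order of `i < j + 1` only
    -- when the root is `α_k` itself.
    by_cases hk : i = k ∧ j = k
    · left
      rw [hk.1, hk.2]
      rfl
    · right
      rw [rootA, simpleA, map_sub, hypRefl_sub_e h1 (by omega) (by omega) (by omega) (by omega),
        hypRefl_sub_e h1 (by omega) (by omega) (by omega) (by omega)]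
      -- The second label of `e_i - e_{j+1}` is one less than its second index, hence the final `-
      -- 1`.
      refine ⟨(if i = k then k + 1 else if i = k + 1 then k else i,
        (if j + 1 = k then k + 1 else if j + 1 = k + 1 then k else j + 1) - 1), ?_, ?_⟩
      · refine ⟨?_, ?_, ?_⟩ <;> dsimp only <;> split_ifs <;> omega
      · rw [rootA]
        congr 2
        dsimp only
        split_ifs <;> omega

theorem lengthsFromHeights_A (n : ℕ) :
    LengthsFromHeights n (simpleA n) (labelsA n) (rootA n) wordA := fun _ hx =>
  (chain_A hx).exists_corootHeight fun _ h1 hn =>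
    inner_sub_self h1 (by omega) (by omega) (by omega) (by omega)

/-! #### Types `B` and `C` -/

/-- Simple roots with last root `a e_n`. -/
def simpleBC (a : ℝ) (n k : ℕ) : Vec n := if k = n then a • e n n else e n k - e n (k + 1)

/-- Positive roots with axis roots `a e_i`. -/
def rootBC (a : ℝ) (n : ℕ) : LabelBC → Vec n
  | .diff i j => e n i - e n j
  | .plus i j => e n i + e n j
  | .axis i => a • e n i

lemma simpleB_eq (n : ℕ) : simpleB n = simpleBC 1 n := by
  funext k
  simp [simpleB, simpleBC]

lemma rootB_eq (n : ℕ) : rootB n = rootBC 1 n := by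
  funext x
  cases x <;> simp [rootB, rootBC]

lemma rootC_eq (n : ℕ) : rootC n = rootBC 2 n := by
  funext x
  cases x <;> simp [rootC, rootBC]

lemma simpleBC_of_lt (a : ℝ) {n k : ℕ} (h : k < n) : simpleBC a n k = e n k - e n (k + 1) :=
  if_neg h.ne

lemma chain_BC {a : ℝ} (ha : 0 < a) {n : ℕ} {x : LabelBC} (hx : x ∈ labelsBC n) :
    Chain n (simpleBC a n) (Set.Iio 0) (rootBC a n x) (wordBC n x) := by
  have hlt : ∀ k, k < n → simpleBC a n k = e n k - e n (k + 1) := fun k => simpleBC_of_lt a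
  have hlast : simpleBC a n n = a • e n n := if_pos rfl
  cases x with
  | diff i j =>
    obtain ⟨hi, hij, hj⟩ : 1 ≤ i ∧ i < j ∧ j ≤ n := hx
    exact (chain_diff hi hij (by omega) hj fun k _ _ => hlt k (by omega)).mono (by simp)
  | axis i =>
    obtain ⟨hi, hin⟩ : 1 ≤ i ∧ i ≤ n := hx
    have hbase := Chain.simple (α := simpleBC a n) (S := Set.Iio 0) (n := n) n (by omega) le_rfl
    have := Chain.shift (a := a) (c := 0) (m := n) (i := i) (n := n) (S := Set.Iio 0) (l := [n])
      (by simpa using ha) hi hin (by omega) le_rfl (fun k _ _ => hlt k (by omega)) (by simp)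
      (by rwa [hlast, ← add_zero (a • e n n)] at hbase)
    simpa [rootBC, wordBC] using this
  | plus i j =>
    obtain ⟨hi, hij, hj⟩ : 1 ≤ i ∧ i < j ∧ j ≤ n := hx
    -- The chain starts at `e_{n-1} - e_n`, the middle letter of `s_n s_{n-1} s_n`. Then `s_n`
    -- changes the sign of `e_n`, the shift `h1` moves `e_{n-1}` to `e_i`, and `h2` moves `e_n` to
    -- `e_j`.
    have hbase := Chain.simple (α := simpleBC a n) (S := Set.Iio 0) (n := n) (n - 1) (by omega)
      (by omega)
    rw [hlt (n - 1) (by omega), Nat.sub_add_cancel (by omega)] at hbase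
    have h0 := hbase.step _ _ n (by omega) le_rfl (by
      rw [hlast, inner_smul_right, inner_sub_left, inner_e_e (by omega) le_rfl,
        inner_e_e (by omega) le_rfl, if_neg (by omega), if_pos rfl]
      simpa using ha)
    rw [hlast, hypRefl_smul ha.ne', map_sub, hypRefl_e (by omega) le_rfl,
      hypRefl_e (by omega) le_rfl, if_neg (by omega), if_pos rfl, sub_neg_eq_add] at h0
    have h1 := Chain.shift (a := 1) (c := e n n) (m := n - 1) (i := i) (n := n) (S := Set.Iio 0)
      (by simp) hi (by omega) (by omega) (by omega) (fun k _ _ => hlt k (by omega))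
      (fun k _ _ => by rw [inner_e_e (by omega) (by omega), if_neg (by omega)])
      (by rwa [one_smul])
    rw [one_smul, add_comm] at h1
    have h2 := Chain.shift (a := 1) (c := e n i) (m := n) (i := j) (n := n) (S := Set.Iio 0)
      (by simp) (by omega) (by omega) (by omega) (by omega) (fun k _ _ => hlt k (by omega))
      (fun k _ _ => by rw [inner_e_e (by omega) (by omega), if_neg (by omega)])
      (by rwa [one_smul])
    rw [one_smul, add_comm] at h2
    simpa [rootBC, wordBC, conjBC] using h2

lemma rootBC_injOn {a : ℝ} (ha : 0 < a) (n : ℕ) : Set.InjOn (rootBC a n) (labelsBC n) := by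
  intro x hx y hy h
  have key : ∀ k, 1 ≤ k → k ≤ n → ⟪rootBC a n x, e n k⟫ = ⟪rootBC a n y, e n k⟫ :=
    fun k _ _ => by rw [h]
  rcases x with ⟨i, j⟩ | ⟨i, j⟩ | i <;> rcases y with ⟨i', j'⟩ | ⟨i', j'⟩ | i' <;>
    simp only [labelsBC, Set.mem_ofPred_eq] at hx hy <;>
    -- All coordinates of both vectors are made explicit; their values at the indices occurring in
    -- the labels separate the labels. Positivity of `a` keeps axis coordinates nonzero.
    have key' : ∀ k, 1 ≤ k → k ≤ n → _ := fun k h1 hn => by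
      have := key k h1 hn
      simp only [rootBC, inner_sub_left, inner_add_left, inner_smul_left, inner_e_e h1 hn,
        conj_trivial] at this
      exact this
  all_goals clear key h
  all_goals grind

theorem isReflectionTable_BC {a : ℝ} (ha : 0 < a) {n : ℕ} :
    IsReflectionTable n (simpleBC a n) (labelsBC n) (rootBC a n) (wordBC n) := by
  refine isReflectionTable_of_chain (descending n) (fun k h1 hn => ?_) ?_ (rootBC_injOn ha n)
    (fun x hx => chain_BC ha hx) (fun k h1 hn => ?_) (fun k h1 hn x hx => ?_)
  · rcases hn.eq_or_lt with rfl | hlt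
    · rw [simpleBC, if_pos rfl, inner_smul_right, inner_descending h1 hn]
      simpa using ha
    · rw [simpleBC_of_lt a hlt, inner_sub_right, inner_descending h1 (by omega),
        inner_descending (by omega) (by omega)]
      push_cast
      linarith
  · have hI := Set.finite_Iic n
    refine (((hI.image2 LabelBC.diff hI).union (hI.image2 LabelBC.plus hI)).union
      (hI.image LabelBC.axis)).subset fun x hx => ?_
    rcases x with ⟨i, j⟩ | ⟨i, j⟩ | i <;> simp only [labelsBC, Set.mem_ofPred_eq] at hx
    · exact .inl (.inl ⟨i, by simp; omega, j, by simp; omega, rfl⟩)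
    · exact .inl (.inr ⟨i, by simp; omega, j, by simp; omega, rfl⟩)
    · exact .inr ⟨i, hx.2, rfl⟩
  · rcases hn.eq_or_lt with rfl | hlt
    · exact ⟨.axis k, ⟨h1, hn⟩, by simp [rootBC, simpleBC]⟩
    · exact ⟨.diff k (k + 1), ⟨h1, by omega, hlt⟩, (simpleBC_of_lt a hlt).symm⟩
  -- The last reflection changes the sign of `e_n` and so exchanges `e_i - e_n` with `e_i + e_n`;
  -- the others transpose neighbouring indices.
  · rcases hn.eq_or_lt with rfl | hlt
    · rw [simpleBC, if_pos rfl, hypRefl_smul ha.ne']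
      rcases x with ⟨i, j⟩ | ⟨i, j⟩ | i <;> simp only [labelsBC, Set.mem_ofPred_eq] at hx <;>
        simp only [rootBC, map_sub, map_add, map_smul, hypRefl_e h1 le_rfl]
      · right
        rw [if_neg (by omega)]
        split_ifs with hj
        · exact ⟨.plus i j, hx, by simp [rootBC]⟩
        · exact ⟨.diff i j, hx, rfl⟩
      · right
        rw [if_neg (by omega)]
        split_ifs with hj
        · exact ⟨.diff i j, hx, by simp [rootBC, sub_eq_add_neg]⟩
        · exact ⟨.plus i j, hx, rfl⟩
      · by_cases hi : i = k
        · left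
          rw [hi]
        · right
          rw [if_neg hi]
          exact ⟨.axis i, hx, rfl⟩
    · rw [simpleBC_of_lt a hlt]
      rcases x with ⟨i, j⟩ | ⟨i, j⟩ | i <;> simp only [labelsBC, Set.mem_ofPred_eq] at hx <;>
        simp only [rootBC, map_sub, map_add, map_smul,
          hypRefl_sub_e h1 (by omega : k ≤ n) (by omega : 1 ≤ k + 1) hlt (by omega : k ≠ k + 1)]
      · by_cases hk : i = k ∧ j = k + 1
        · left
          rw [hk.1, hk.2]
        · right
          refine ⟨.diff _ _, ?_, rfl⟩
          simp only [labelsBC, Set.mem_ofPred_eq]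
          split_ifs <;> omega
      · right
        by_cases hk : i = k ∧ j = k + 1
        · refine ⟨.plus i j, hx, ?_⟩
          rw [rootBC, hk.1, hk.2, add_comm]
          simp
        · refine ⟨.plus _ _, ?_, rfl⟩
          simp only [labelsBC, Set.mem_ofPred_eq]
          split_ifs <;> omega
      · right
        refine ⟨.axis _, ?_, rfl⟩
        simp only [labelsBC, Set.mem_ofPred_eq]
        split_ifs <;> omega

/-! #### Type `D` -/

lemma simpleD_of_lt {n k : ℕ} (h : k < n) : simpleD n k = e n k - e n (k + 1) := if_neg h.ne

lemma chain_D {n : ℕ} (hn : 3 ≤ n) {x : LabelD} (hx : x ∈ labelsD n) :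
    Chain n (simpleD n) {-1} (rootD n x) (wordD n x) := by
  have hlt : ∀ k, k < n → simpleD n k = e n k - e n (k + 1) := fun k => simpleD_of_lt
  have hlast : simpleD n n = e n (n - 1) + e n n := if_pos rfl
  have hbase := Chain.simple (α := simpleD n) (S := {-1}) (n := n) n (by omega) le_rfl
  rw [hlast] at hbase
  cases x with
  | diff i j =>
    obtain ⟨hi, hij, hj⟩ : 1 ≤ i ∧ i < j ∧ j ≤ n := hx
    exact chain_diff hi hij (by omega) hj fun k _ _ => hlt k (by omega)
  | plus i j =>
    obtain ⟨hi, hij, hj⟩ : 1 ≤ i ∧ i < j ∧ j ≤ n := hx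
    by_cases hjn : j = n
    · have h1 := Chain.shift (a := 1) (c := e n n) (m := n - 1) (i := i) (n := n) (S := {-1})
        rfl hi (by omega) (by omega) (by omega) (fun k _ _ => hlt k (by omega))
        (fun k _ _ => by rw [inner_e_e (by omega) (by omega), if_neg (by omega)])
        (by rwa [one_smul])
      rw [one_smul] at h1
      simpa [rootD, wordD, hjn] using h1
    -- From `e_{n-1} + e_n`, the shifts `h1` and `h2` reach `e_{n-2} + e_{n-1}` and produce the five
    -- middle letters. Then `h3` moves `e_{n-2}` to `e_i`, and `h4` moves `e_{n-1}` to `e_j`.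
    · have hico : ∀ m, List.Ico m (m + 1) = [m] := fun m => List.Ico.succ_singleton
      have h1 := Chain.shift (a := 1) (c := e n n) (m := n - 1) (i := n - 2) (n := n) (S := {-1})
        rfl (by omega) (by omega) (by omega) (by omega) (fun k _ _ => hlt k (by omega))
        (fun k _ _ => by rw [inner_e_e (by omega) (by omega), if_neg (by omega)])
        (by rwa [one_smul])
      rw [one_smul, add_comm] at h1
      have h2 := Chain.shift (a := 1) (c := e n (n - 2)) (m := n) (i := n - 1) (n := n) (S := {-1})
        rfl (by omega) (by omega) (by omega) (by omega) (fun k _ _ => hlt k (by omega))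
        (fun k _ _ => by rw [inner_e_e (by omega) (by omega), if_neg (by omega)])
        (by rwa [one_smul])
      rw [one_smul, add_comm] at h2
      have h3 := Chain.shift (a := 1) (c := e n (n - 1)) (m := n - 2) (i := i) (n := n) (S := {-1})
        rfl (by omega) (by omega) (by omega) (by omega) (fun k _ _ => hlt k (by omega))
        (fun k _ _ => by rw [inner_e_e (by omega) (by omega), if_neg (by omega)])
        (by rwa [one_smul])
      rw [one_smul, add_comm] at h3
      have h4 := Chain.shift (a := 1) (c := e n i) (m := n - 1) (i := j) (n := n) (S := {-1})
        rfl (by omega) (by omega) (by omega) (by omega) (fun k _ _ => hlt k (by omega))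
        (fun k _ _ => by rw [inner_e_e (by omega) (by omega), if_neg (by omega)])
        (by rwa [one_smul])
      rw [one_smul, add_comm] at h4
      have i1 : List.Ico (n - 2) (n - 1) = [n - 2] := by
        rw [← hico, show n - 2 + 1 = n - 1 by omega]
      have i2 : List.Ico (n - 1) n = [n - 1] := by
        rw [← hico, show n - 1 + 1 = n by omega]
      simpa [rootD, wordD, conjD, hjn, i1, i2] using h4

lemma rootD_injOn (n : ℕ) : Set.InjOn (rootD n) (labelsD n) := by
  intro x hx y hy h
  have key : ∀ k, 1 ≤ k → k ≤ n → ⟪rootD n x, e n k⟫ = ⟪rootD n y, e n k⟫ :=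
    fun k _ _ => by rw [h]
  rcases x with ⟨i, j⟩ | ⟨i, j⟩ <;> rcases y with ⟨i', j'⟩ | ⟨i', j'⟩ <;>
    simp only [labelsD, Set.mem_ofPred_eq] at hx hy <;>
    have key' : ∀ k, 1 ≤ k → k ≤ n → _ := fun k h1 hn => by
      have := key k h1 hn
      simp only [rootD, inner_sub_left, inner_add_left, inner_e_e h1 hn] at this
      exact this
  all_goals clear key h
  all_goals grind

theorem isReflectionTable_D {n : ℕ} (hn3 : 3 ≤ n) :
    IsReflectionTable n (simpleD n) (labelsD n) (rootD n) (wordD n) := by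
  refine isReflectionTable_of_chain (descending n) (fun k h1 hn => ?_) ?_ (rootD_injOn n)
    (fun x hx => (chain_D hn3 hx).mono (by simp)) (fun k h1 hn => ?_) (fun k h1 hn x hx => ?_)
  · rcases hn.eq_or_lt with rfl | hlt
    · rw [simpleD, if_pos rfl, inner_add_right, inner_descending h1 hn,
        inner_descending (by omega) (by omega), Nat.cast_sub h1]
      push_cast
      linarith
    · rw [simpleD_of_lt hlt, inner_sub_right, inner_descending h1 (by omega),
        inner_descending (by omega) (by omega)]
      push_cast
      linarith
  · have hI := Set.finite_Iic n
    refine ((hI.image2 LabelD.diff hI).union (hI.image2 LabelD.plus hI)).subset fun x hx => ?_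
    rcases x with ⟨i, j⟩ | ⟨i, j⟩ <;> simp only [labelsD, Set.mem_ofPred_eq] at hx
    · exact .inl ⟨i, by simp; omega, j, by simp; omega, rfl⟩
    · exact .inr ⟨i, by simp; omega, j, by simp; omega, rfl⟩
  · rcases hn.eq_or_lt with rfl | hlt
    · refine ⟨.plus (k - 1) k, ?_, by simp [rootD, simpleD]⟩
      simp only [labelsD, Set.mem_ofPred_eq]
      omega
    · exact ⟨.diff k (k + 1), ⟨h1, by omega, hlt⟩, (simpleD_of_lt hlt).symm⟩
  -- The last reflection sends `e_{n-1}` to `-e_n` and `e_n` to `-e_{n-1}`. It fixes `e_{n-1} -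
  -- e_n`, and for `i < n - 1` it exchanges `e_i ∓ e_n` with `e_i ± e_{n-1}`.
  · rcases hn.eq_or_lt with rfl | hlt
    · rw [simpleD, if_pos rfl]
      rcases x with ⟨i, j⟩ | ⟨i, j⟩ <;> simp only [labelsD, Set.mem_ofPred_eq] at hx <;>
        simp only [rootD, map_sub, map_add, hypRefl_add_e (by omega : 1 ≤ k - 1)
          (by omega : k - 1 ≤ k) h1 le_rfl (by omega : k - 1 ≠ k)]
      · right
        by_cases hi : i = k - 1
        · refine ⟨.diff i j, hx, ?_⟩
          rw [if_pos hi, if_neg (by omega), if_pos (by omega), rootD,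
            show j = k by omega, hi, neg_sub_neg]
        · rw [if_neg hi, if_neg (by omega)]
          split_ifs with h2 h3
          · exact ⟨.plus i k, ⟨hx.1, by omega, le_rfl⟩, by simp [rootD]⟩
          · exact ⟨.plus i (k - 1), ⟨hx.1, by omega, by omega⟩, by simp [rootD]⟩
          · exact ⟨.diff i j, hx, rfl⟩
      · by_cases hi : i = k - 1
        · left
          rw [hi, show j = k by omega]
        · right
          rw [if_neg hi, if_neg (by omega)]
          split_ifs with h2 h3
          · exact ⟨.diff i k, ⟨hx.1, by omega, le_rfl⟩, by simp [rootD, sub_eq_add_neg]⟩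
          · exact ⟨.diff i (k - 1), ⟨hx.1, by omega, by omega⟩, by simp [rootD, sub_eq_add_neg]⟩
          · exact ⟨.plus i j, hx, rfl⟩
    · rw [simpleD_of_lt hlt]
      rcases x with ⟨i, j⟩ | ⟨i, j⟩ <;> simp only [labelsD, Set.mem_ofPred_eq] at hx <;>
        simp only [rootD, map_sub, map_add,
          hypRefl_sub_e h1 (by omega : k ≤ n) (by omega : 1 ≤ k + 1) hlt (by omega : k ≠ k + 1)]
      · by_cases hk : i = k ∧ j = k + 1
        · left
          rw [hk.1, hk.2]
        · right
          refine ⟨.diff _ _, ?_, rfl⟩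
          simp only [labelsD, Set.mem_ofPred_eq]
          split_ifs <;> omega
      · right
        by_cases hk : i = k ∧ j = k + 1
        · refine ⟨.plus i j, hx, ?_⟩
          rw [rootD, hk.1, hk.2, add_comm]
          simp
        · refine ⟨.plus _ _, ?_, rfl⟩
          simp only [labelsD, Set.mem_ofPred_eq]
          split_ifs <;> omega

theorem lengthsFromHeights_D {n : ℕ} (hn3 : 3 ≤ n) :
    LengthsFromHeights n (simpleD n) (labelsD n) (rootD n) (wordD n) := fun _ hx =>
  (chain_D hn3 hx).exists_corootHeight fun k h1 hn => by
    rcases hn.eq_or_lt with rfl | hlt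
    · rw [simpleD, if_pos rfl]
      exact inner_add_self (by omega) (by omega) h1 le_rfl (by omega)
    · rw [simpleD_of_lt hlt]
      exact inner_sub_self h1 hn (by omega) hlt (by omega)


/-! ### Half-integral vectors and the exceptional types -/

/-- The vector with coordinates `L_i / 2`. -/
def halfVec (d : ℕ) (L : List ℤ) : Vec d :=
  WithLp.toLp 2 fun k => ((L.getD (k : ℕ) 0 : ℤ) : ℝ) / 2

/-- The dot product of two lists. -/
def dot : List ℤ → List ℤ → ℤ
  | a :: L, b :: M => a * b + dot L M
  | _, _ => 0

/-- `L - c M`, coordinatewise. -/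
def subMul (c : ℤ) (L M : List ℤ) : List ℤ := List.zipWith (fun a b => a - c * b) L M

/-- The reflection of `L` in the hyperplane orthogonal to `M`, if it is integral. -/
def listRefl (M L : List ℤ) : List ℤ := subMul (2 * dot L M / dot M M) L M

/-- The root obtained from `A k` by reflecting successively in the letters of the word `u`, read
from the right; `none` if a letter is not in `{1, …, n}`, a dot product fails `p`, or a
reflection is not integral. -/
def chainEval (n : ℕ) (A : ℕ → List ℤ) (p : ℤ → Bool) (k : ℕ) : List ℕ → Option (List ℤ)
  | [] => if 1 ≤ k ∧ k ≤ n then some (A k) else none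
  | j :: u => match chainEval n A p k u with
    | none => none
    | some L => if 1 ≤ j ∧ j ≤ n ∧ p (dot L (A j)) ∧ dot (A j) (A j) ∣ 2 * dot L (A j) then
        some (listRefl (A j) L) else none

/-- The finite verification that `tbl` is a table of reflections for the simple roots with doubled
coordinates `A 1, …, A n`. -/
structure TableCheck (d n : ℕ) (A : ℕ → List ℤ) (ρ : List ℤ) (p : ℤ → Bool) (tbl : List Row) :
    Prop where
  length_simple : ∀ k ∈ Finset.Icc 1 n, (A k).length = d
  dot_pos : ∀ k ∈ Finset.Icc 1 n, 0 < dot ρ (A k)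
  length_coords : ∀ r ∈ tbl, r.coords.length = d
  palindrome : ∀ r ∈ tbl, r.word = r.word.take (r.word.length / 2) ++
    [r.word.getD (r.word.length / 2) 0] ++ (r.word.take (r.word.length / 2)).reverse
  chain : ∀ r ∈ tbl, chainEval n A p (r.word.getD (r.word.length / 2) 0)
    (r.word.take (r.word.length / 2)) = some r.coords
  expansion : ∀ r ∈ tbl, ∀ i ∈ List.range d, r.coords.getD i 0 =
    ∑ k ∈ Finset.Icc 1 n, (r.coeffs.getD (k - 1) 0 : ℤ) * (A k).getD i 0
  nodup : (tbl.map Row.coords).Nodup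
  simple_mem : ∀ k ∈ Finset.Icc 1 n, A k ∈ tbl.map Row.coords
  refl_mem : ∀ k ∈ Finset.Icc 1 n, ∀ r ∈ tbl, r.coords = A k ∨
    dot (A k) (A k) ∣ 2 * dot r.coords (A k) ∧ listRefl (A k) r.coords ∈ tbl.map Row.coords

/-! ### From integer lists to Euclidean vectors. -/

lemma dot_eq_sum (d : ℕ) (L M : List ℤ) (hL : L.length ≤ d) :
    dot L M = ∑ i ∈ Finset.range d, L.getD i 0 * M.getD i 0 := by
  induction L generalizing d M with
  | nil => simp [dot]
  | cons a L ih =>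
    obtain ⟨d, rfl⟩ : ∃ e, d = e + 1 := ⟨d - 1, by simp at hL; omega⟩
    cases M with
    | nil => simp [dot]
    | cons b M =>
      rw [Finset.sum_range_succ', dot, ih d M (by simpa using hL)]
      simp [add_comm]

lemma inner_halfVec {d : ℕ} {L M : List ℤ} (hL : L.length = d) :
    ⟪halfVec d L, halfVec d M⟫ = (dot L M : ℝ) / 4 := by
  rw [dot_eq_sum d L M hL.le, Finset.sum_range, PiLp.inner_apply, Int.cast_sum, Finset.sum_div]
  refine Finset.sum_congr rfl fun i _ => ?_
  simp only [halfVec, RCLike.inner_apply, conj_trivial, Int.cast_mul]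
  ring

lemma subMul_getD {c : ℤ} {L M : List ℤ} (h : L.length = M.length) (i : ℕ) :
    (subMul c L M).getD i 0 = L.getD i 0 - c * M.getD i 0 := by
  by_cases hi : i < L.length
  · rw [subMul, List.getD_eq_getElem _ _ (by simpa [h] using h ▸ hi), List.getD_eq_getElem _ _ hi,
      List.getD_eq_getElem _ _ (h ▸ hi), List.getElem_zipWith]
  · rw [subMul, List.getD_eq_default _ _ (by simp; omega), List.getD_eq_default _ _ (by omega),
      List.getD_eq_default _ _ (by omega)]
    simp

lemma length_listRefl {d : ℕ} {L M : List ℤ} (hL : L.length = d) (hM : M.length = d) :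
    (listRefl M L).length = d := by
  simp [listRefl, subMul, hL, hM]

/-- Divisibility makes the integer quotient in `listRefl` the exact reflection coefficient; the
factors of the doubled coordinates cancel in it. -/
lemma hypRefl_halfVec {d : ℕ} {L M : List ℤ} (hL : L.length = d) (hM : M.length = d)
    (hdvd : dot M M ∣ 2 * dot L M) :
    hypRefl (halfVec d M) (halfVec d L) = halfVec d (listRefl M L) := by
  have hc : 2 * ⟪halfVec d M, halfVec d L⟫ / ⟪halfVec d M, halfVec d M⟫ =
      ((2 * dot L M / dot M M : ℤ) : ℝ) := by
    rw [real_inner_comm, inner_halfVec hL, inner_halfVec hM, Int.cast_div_charZero hdvd]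
    push_cast
    rw [← mul_div_assoc, div_div_div_cancel_right₀ (by norm_num)]
  rw [hypRefl_apply, hc]
  ext i
  simp only [halfVec, listRefl, PiLp.sub_apply, PiLp.smul_apply, smul_eq_mul,
    subMul_getD (hL.trans hM.symm)]
  push_cast
  ring

lemma halfVec_injective {d : ℕ} {L M : List ℤ} (hL : L.length = d) (hM : M.length = d)
    (h : halfVec d L = halfVec d M) : L = M := by
  refine List.ext_getElem (hL.trans hM.symm) fun i h1 h2 => ?_
  have hi := congrFun (congrArg WithLp.ofLp h) ⟨i, hL ▸ h1⟩
  simp only [halfVec, List.getD_eq_getElem _ _ h1, List.getD_eq_getElem _ _ h2] at hi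
  exact_mod_cast (div_left_inj' (two_ne_zero' ℝ)).1 hi

/-- A successful evaluation has tested every condition of a chain, letter by letter. The divisor 4
in `hp` comes from doubling both arguments of the inner product. -/
lemma chain_of_chainEval {d n : ℕ} {α : ℕ → Vec d} {A : ℕ → List ℤ} {p : ℤ → Bool} {S : Set ℝ}
    (hα : ∀ k ∈ Finset.Icc 1 n, α k = halfVec d (A k))
    (hd : ∀ k ∈ Finset.Icc 1 n, (A k).length = d) (hp : ∀ t, p t → (t : ℝ) / 4 ∈ S)
    (k : ℕ) (u : List ℕ) (L : List ℤ) (h : chainEval n A p k u = some L) :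
    L.length = d ∧ Chain n α S (halfVec d L) (u ++ [k] ++ u.reverse) := by
  induction u generalizing L with
  | nil =>
    rw [chainEval] at h
    split_ifs at h with hk
    obtain rfl := Option.some.inj h
    have hk' := Finset.mem_Icc.2 hk
    exact ⟨hd k hk', hα k hk' ▸ .simple k hk.1 hk.2⟩
  | cons j u ih =>
    rw [chainEval] at h
    split at h
    · simp at h
    · rename_i M hM
      split_ifs at h with hj
      obtain rfl := Option.some.inj h
      obtain ⟨hMd, hc⟩ := ih M hM
      have hj' := Finset.mem_Icc.2 ⟨hj.1, hj.2.1⟩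
      refine ⟨length_listRefl hMd (hd j hj'), ?_⟩
      rw [← hypRefl_halfVec hMd (hd j hj') hj.2.2.2, ← hα j hj']
      simpa using hc.step _ _ j hj.1 hj.2.1
        (by rw [hα j hj', inner_halfVec hMd]; exact hp _ hj.2.2.1)

lemma halfVec_mem_image {d : ℕ} {tbl : List Row} {L : List ℤ} (hL : L ∈ tbl.map Row.coords) :
    halfVec d L ∈ (fun x => (tbl.get x).root d) '' Set.univ := by
  obtain ⟨r, hr, rfl⟩ := List.mem_map.1 hL
  obtain ⟨i, rfl⟩ := List.get_of_mem hr
  exact ⟨i, trivial, rfl⟩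

namespace TableCheck

variable {d n : ℕ} {A : ℕ → List ℤ} {ρ : List ℤ} {p : ℤ → Bool} {tbl : List Row} {α : ℕ → Vec d}
  {S : Set ℝ}

lemma chain_get (h : TableCheck d n A ρ p tbl) (hα : ∀ k ∈ Finset.Icc 1 n, α k = halfVec d (A k))
    (hp : ∀ t, p t → (t : ℝ) / 4 ∈ S) {r : Row} (hr : r ∈ tbl) :
    Chain n α S (r.root d) r.word := by
  rw [h.palindrome r hr]
  exact (chain_of_chainEval hα h.length_simple hp _ _ _ (h.chain r hr)).2

theorem isExceptionalTable (h : TableCheck d n A ρ p tbl)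
    (hα : ∀ k ∈ Finset.Icc 1 n, α k = halfVec d (A k)) (hρ : ρ.length = d)
    (hp : ∀ t, p t → t < 0) : IsExceptionalTable n α tbl where
  table := by
    refine isReflectionTable_of_chain (halfVec d ρ) (fun k h1 hn => ?_) Set.finite_univ
      (fun x _ y _ hxy => ?_) (fun x _ => ?_) (fun k h1 hn => ?_) (fun k h1 hn x _ => ?_)
    · have hk := Finset.mem_Icc.2 ⟨h1, hn⟩
      rw [hα k hk, inner_halfVec hρ]
      have := h.dot_pos k hk
      positivity
    · have := halfVec_injective (h.length_coords _ (tbl.get_mem x))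
        (h.length_coords _ (tbl.get_mem y)) hxy
      -- Distinctness is known for the mapped list of coordinates, so row indices are transported to
      -- its length.
      have hinj := List.nodup_iff_injective_get.1 h.nodup
      have := @hinj (x.cast (by simp)) (y.cast (by simp)) (by simpa using this)
      exact Fin.cast_injective _ this
    · refine h.chain_get hα (fun t ht => ?_) (tbl.get_mem x)
      have : (t : ℝ) < 0 := by exact_mod_cast hp t ht
      exact Set.mem_Iio.2 (by linarith)
    · have hk := Finset.mem_Icc.2 ⟨h1, hn⟩
      rw [hα k hk]
      exact halfVec_mem_image (h.simple_mem k hk)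
    · have hk := Finset.mem_Icc.2 ⟨h1, hn⟩
      rw [hα k hk]
      rcases h.refl_mem k hk _ (tbl.get_mem x) with hx | ⟨hdvd, hx⟩
      · exact .inl (congrArg (halfVec d) hx)
      · right
        have := hypRefl_halfVec (h.length_coords _ (tbl.get_mem x)) (h.length_simple k hk) hdvd
        change hypRefl _ (halfVec d _) ∈ _
        rw [this]
        exact halfVec_mem_image hx
  expansion r hr := by
    ext i
    have := h.expansion r hr i (List.mem_range.2 i.2)
    simp only [Row.root, Row.expansion, WithLp.ofLp_sum, Finset.sum_apply, PiLp.smul_apply, this]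
    push_cast
    rw [Finset.sum_div]
    refine Finset.sum_congr rfl fun k hk => ?_
    rw [hα k hk, halfVec, smul_eq_mul]
    ring

theorem lengthsFromHeights (h : TableCheck d n A ρ p tbl)
    (hα : ∀ k ∈ Finset.Icc 1 n, α k = halfVec d (A k)) (hp : ∀ t, p t → t = -4)
    (hA : ∀ k ∈ Finset.Icc 1 n, dot (A k) (A k) = 8) :
    LengthsFromHeights n α (Set.univ : Set (Fin tbl.length)) (fun x => (tbl.get x).root d)
      (fun x => (tbl.get x).word) := by
  refine fun x _ => Chain.exists_corootHeight (fun k h1 hn => ?_)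
    (h.chain_get hα (fun t ht => ?_) (tbl.get_mem x))
  · have hk := Finset.mem_Icc.2 ⟨h1, hn⟩
    rw [hα k hk, inner_halfVec (h.length_simple k hk), hA k hk]
    norm_num
  · rw [hp t ht]
    norm_num

end TableCheck

/-- Doubled coordinates of the simple roots of type `E_8`. -/
def coordsE : ℕ → List ℤ
  | 1 => [1, -1, -1, -1, -1, -1, -1, 1]
  | 2 => [2, 2, 0, 0, 0, 0, 0, 0]
  | 3 => [-2, 2, 0, 0, 0, 0, 0, 0]
  | 4 => [0, -2, 2, 0, 0, 0, 0, 0]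
  | 5 => [0, 0, -2, 2, 0, 0, 0, 0]
  | 6 => [0, 0, 0, -2, 2, 0, 0, 0]
  | 7 => [0, 0, 0, 0, -2, 2, 0, 0]
  | 8 => [0, 0, 0, 0, 0, -2, 2, 0]
  | _ => []

/-- Doubled coordinates of the simple roots of type `F_4`. -/
def coordsF : ℕ → List ℤ
  | 1 => [0, 2, -2, 0]
  | 2 => [0, 0, 2, -2]
  | 3 => [0, 0, 0, 2]
  | 4 => [1, -1, -1, -1]
  | _ => []

/-- Doubled coordinates of the simple roots of type `G_2`. -/
def coordsG : ℕ → List ℤ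
  | 1 => [2, -2, 0]
  | 2 => [-4, 2, 2]
  | _ => []

/-! ### Coordinates of the simple roots and the finite verifications. -/

lemma simpleE_eq {n : ℕ} (hn : n ≤ 8) :
    ∀ k ∈ Finset.Icc 1 n, simpleE k = halfVec 8 (coordsE k) := by
  intro k hk
  obtain ⟨h1, h2⟩ := Finset.mem_Icc.1 hk
  have h3 := h2.trans hn
  interval_cases k <;> ext i <;> fin_cases i <;> norm_num [simpleE, halfVec, coordsE, e]

lemma simpleF_eq : ∀ k ∈ Finset.Icc 1 4, simpleF k = halfVec 4 (coordsF k) := by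
  intro k hk
  obtain ⟨h1, h2⟩ := Finset.mem_Icc.1 hk
  interval_cases k <;> ext i <;> fin_cases i <;> norm_num [simpleF, halfVec, coordsF, e]

lemma simpleG_eq : ∀ k ∈ Finset.Icc 1 2, simpleG k = halfVec 3 (coordsG k) := by
  intro k hk
  obtain ⟨h1, h2⟩ := Finset.mem_Icc.1 hk
  interval_cases k <;> ext i <;> fin_cases i <;> norm_num [simpleG, halfVec, coordsG, e]

/-- The vector `[-1, -2, 1]` serves as `ρ`; it need not lie in the span of the roots, only have
positive dot products with the simple ones. -/
lemma check_G2 : TableCheck 3 2 coordsG [-1, -2, 1] (· < 0) tableG2 := by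
  constructor <;> decide +kernel

lemma check_F4 : TableCheck 4 4 coordsF [11, 5, 3, 1] (· < 0) tableF4 := by
  constructor <;> decide +kernel

/-- The vector is the half-sum of the positive roots of `E_8`; being positive on all eight simple
roots, it also serves `E_6` and `E_7`. In doubled coordinates, inner product `-1` becomes `-4`. -/
lemma check_E6 : TableCheck 8 6 coordsE [0, 1, 2, 3, 4, 5, 6, 23] (· = -4) tableE6 := by
  constructor <;> decide +kernel

lemma check_E7 : TableCheck 8 7 coordsE [0, 1, 2, 3, 4, 5, 6, 23] (· = -4) tableE7 := by
  constructor <;> decide +kernel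

lemma check_E8 : TableCheck 8 8 coordsE [0, 1, 2, 3, 4, 5, 6, 23] (· = -4) tableE8 := by
  constructor <;> decide +kernel

lemma dot_coordsE_self {n : ℕ} (hn : n ≤ 8) :
    ∀ k ∈ Finset.Icc 1 n, dot (coordsE k) (coordsE k) = 8 := by
  intro k hk
  obtain ⟨h1, h2⟩ := Finset.mem_Icc.1 hk
  have h3 := h2.trans hn
  interval_cases k <;> rfl

end WeylWords

end

theorem theorem1p1 :
    -- type `A_n`
    (∀ n : ℕ, 1 ≤ n →
      IsReflectionTable n (simpleA n) (labelsA n) (rootA n) wordA ∧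
      LengthsFromHeights n (simpleA n) (labelsA n) (rootA n) wordA) ∧
    -- type `B_n`
    (∀ n : ℕ, 2 ≤ n → IsReflectionTable n (simpleB n) (labelsBC n) (rootB n) (wordBC n)) ∧
    -- type `C_n`
    (∀ n : ℕ, 2 ≤ n → IsReflectionTable n (simpleC n) (labelsBC n) (rootC n) (wordBC n)) ∧
    -- type `D_n`
    (∀ n : ℕ, 4 ≤ n →
      IsReflectionTable n (simpleD n) (labelsD n) (rootD n) (wordD n) ∧
      LengthsFromHeights n (simpleD n) (labelsD n) (rootD n) (wordD n)) ∧
    -- types `E_6`, `E_7`, `E_8`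
    (IsExceptionalTable 6 simpleE tableE6 ∧
      LengthsFromHeights 6 simpleE (Set.univ : Set (Fin tableE6.length))
        (fun x => (tableE6.get x).root 8) (fun x => (tableE6.get x).word)) ∧
    (IsExceptionalTable 7 simpleE tableE7 ∧
      LengthsFromHeights 7 simpleE (Set.univ : Set (Fin tableE7.length))
        (fun x => (tableE7.get x).root 8) (fun x => (tableE7.get x).word)) ∧
    (IsExceptionalTable 8 simpleE tableE8 ∧
      LengthsFromHeights 8 simpleE (Set.univ : Set (Fin tableE8.length))
        (fun x => (tableE8.get x).root 8) (fun x => (tableE8.get x).word)) ∧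
    -- type `F_4`
    IsExceptionalTable 4 simpleF tableF4 ∧
    -- type `G_2`
    IsExceptionalTable 2 simpleG tableG2 := by
  refine ⟨fun n _ => ⟨isReflectionTable_A n, lengthsFromHeights_A n⟩, fun n _ => ?_, fun n _ => ?_,
    fun n hn => ⟨isReflectionTable_D (by omega), lengthsFromHeights_D (by omega)⟩,
    ⟨check_E6.isExceptionalTable (simpleE_eq (by norm_num)) rfl (by simp +contextual),
      check_E6.lengthsFromHeights (simpleE_eq (by norm_num)) (by simp)
        (dot_coordsE_self (by norm_num))⟩,
    ⟨check_E7.isExceptionalTable (simpleE_eq (by norm_num)) rfl (by simp +contextual),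
      check_E7.lengthsFromHeights (simpleE_eq (by norm_num)) (by simp)
        (dot_coordsE_self (by norm_num))⟩,
    ⟨check_E8.isExceptionalTable (simpleE_eq (by norm_num)) rfl (by simp +contextual),
      check_E8.lengthsFromHeights (simpleE_eq (by norm_num)) (by simp)
        (dot_coordsE_self (by norm_num))⟩,
    check_F4.isExceptionalTable simpleF_eq rfl (by simp),
    check_G2.isExceptionalTable simpleG_eq rfl (by simp)⟩
  · rw [simpleB_eq, rootB_eq]
    exact isReflectionTable_BC one_pos
  -- Type `C_n` is the uniform family at `a = 2` by definition, whereas type `B_n` first needs `1 •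
  -- e_n` identified with `e_n`.
  · change IsReflectionTable n (simpleBC 2 n) _ _ _
    rw [rootC_eq]
    exact isReflectionTable_BC two_pos
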